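/- Let $A_1,\dots,A_k\in M_n(\mathbb C)$, let $\Delta=\{\alpha\in[0,1]^k:\sum_i\alpha_i=1\}$, write $A(\alpha)=\sum_i\alpha_iA_i$ and $Co=Co(A_1,\dots,A_k)=\{A(\alpha):\alpha\in\Delta\}$. For $S\subseteq Co$ the eigen-surface of $S$ is $$ES(S)=\{(\alpha,\mu)\in\Delta\times\mathbb C:\ A(\alpha)\in S,\ \mu \text{ is an eigenvalue of } A(\alpha)\}\subseteq\mathbb R^k\times\mathbb C .$$ Two points of $ES(S)$ are paired in $S$ if they lie in the same path component of $ES(S)$. The multiplicity list of a matrix is $(a_n,\dots,a_1)$, where $a_j$ is the number of its distinct eigenvalues of algebraic multiplicity $j$. The core $\mathcal C$ is the set of matrices in $Co$ whose multiplicity list is lexicographically smallest, and $\mathcal U=Co\setminus\mathcal C$; $Co$ is regular if the smallest multiplicity list is $(0,\dots,0,n)$. Let $\mathbf B_\varepsilon$ denote open Euclidean balls, in $M_n(\mathbb C)$ (Frobenius norm) or in $\mathbb R^k\times\mathbb C$. For $A=A(\alpha)\in\mathcal U$ and $\lambda(A)=(\alpha,\lambda)\in ES(Co)$, the matrix $A$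 is locally non-transitive about $\lambda(A)$ if for all sufficiently small $\varepsilon>0$ and every $\beta\in\Delta$ with $B=A(\beta)\in\mathbf B_\varepsilon(A)\cap\mathcal C$, any two points $(\beta,\mu_1),(\beta,\mu_2)$ of $ES(Co)$ that are both paired with $\lambda(A)$ in $\mathbf B_\varepsilon(A)\cap Co$ are paired with each other in $\mathbf B_\varepsilon(A)\cap\mathcal C$. **Theorem.** Let $Co(A_1,\dots,A_k)$ be regular, and let $\mathcal U$ have codimension at least $2$, that is, let $\{\alpha\in\Delta: A(\alpha)\in\mathcal U\}$ have (Hausdorff) dimension at most $k-3$. If $A=A(\alpha)\in\mathcal U$ is not locally non-transitive about $\lambda(A)=(\alpha,\lambda)\in ES(Co)$, where $\lambda$ is an eigenvalue of $A$ of algebraic multiplicity $>1$, then there is no $\varepsilon>0$ such that $$\mathbf B_\varepsilon(\lambda(A))\cap ES(Co(A_1,\dots,A_k))$$ is a topological manifold, with or without boundary, of any dimension. -/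

import Mathlib

open Set Topology
open scoped ENNReal

namespace EigenSurface

variable {n k : ℕ}

/-- The matrix `α₁ A₁ + ⋯ + α_k A_k` with real coefficients `α`. -/
noncomputable def combo (A : Fin k → Matrix (Fin n) (Fin n) ℂ) (α : Fin k → ℝ) :
    Matrix (Fin n) (Fin n) ℂ :=
  ∑ i, α i • A i

/-- `Co(A₁, …, A_k)`: the matrices `∑ αᵢ Aᵢ` with `αᵢ ≥ 0` and `∑ αᵢ = 1`. -/
def Co (A : Fin k → Matrix (Fin n) (Fin n) ℂ) : Set (Matrix (Fin n) (Fin n) ℂ) :=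
  {M | ∃ α ∈ stdSimplex ℝ (Fin k), M = combo A α}

/-- The eigen-surface `ES(S)` of a set of matrices `S ⊆ Co(A₁, …, A_k)`, in the coefficients
provided by the convex hull: all `(α₁, …, α_k, μ)` with `α` in the standard simplex,
`α₁ A₁ + ⋯ + α_k A_k ∈ S`, and `μ` an eigenvalue of this matrix. -/
def ES (A : Fin k → Matrix (Fin n) (Fin n) ℂ) (S : Set (Matrix (Fin n) (Fin n) ℂ)) :
    Set ((Fin k → ℝ) × ℂ) :=
  {q | q.1 ∈ stdSimplex ℝ (Fin k) ∧ combo A q.1 ∈ S ∧ q.2 ∈ spectrum ℂ (combo A q.1)}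

/-- The multiplicity list `(a_n, …, a₁)` of a matrix, where `a_j` is the number of distinct
eigenvalues of algebraic multiplicity `j`. The entry at position `i = 0, …, n - 1` is `a_{n-i}`;
lists are compared lexicographically, starting with `a_n`. -/
noncomputable def multList (M : Matrix (Fin n) (Fin n) ℂ) : Lex (Fin n → ℕ) :=
  toLex fun i => {μ : ℂ | M.charpoly.rootMultiplicity μ = n - (i : ℕ)}.ncard

/-- The core `𝒞` of the convex hull: its matrices of smallest multiplicity list. -/
def core (A : Fin k → Matrix (Fin n) (Fin n) ℂ) : Set (Matrix (Fin n) (Fin n) ℂ) :=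
  {M | M ∈ Co A ∧ ∀ B ∈ Co A, multList M ≤ multList B}

/-- The complement `𝒰 = Co(A₁, …, A_k) ∖ 𝒞` of the core. -/
def nonCore (A : Fin k → Matrix (Fin n) (Fin n) ℂ) : Set (Matrix (Fin n) (Fin n) ℂ) :=
  Co A \ core A

/-- The convex hull is regular if the smallest multiplicity list of its matrices is
`(0, …, 0, n)`. -/
def IsRegular (A : Fin k → Matrix (Fin n) (Fin n) ℂ) : Prop :=
  IsLeast (multList '' Co A) (toLex fun i : Fin n => if (i : ℕ) + 1 = n then n else 0)

/-- The set of coefficients, in the `(k - 1)`-dimensional simplex, of the matrices in `𝒰`. -/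
def nonCoreCoeff (A : Fin k → Matrix (Fin n) (Fin n) ℂ) : Set (Fin k → ℝ) :=
  {α | α ∈ stdSimplex ℝ (Fin k) ∧ combo A α ∈ nonCore A}

/-- `𝒰` has codimension at least two, that is, dimension at most `k - 3` inside the
`(k - 1)`-dimensional simplex of coefficients. The set is semialgebraic, so that its dimension is
its Hausdorff dimension. -/
def CodimAtLeastTwo (A : Fin k → Matrix (Fin n) (Fin n) ℂ) : Prop :=
  dimH (nonCoreCoeff A) + 2 ≤ ((k - 1 : ℕ) : ℝ≥0∞)

/-- The open ball `𝐁_ε(M)` for the Euclidean (Frobenius) norm on the space of matrices. -/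
def matrixBall (M : Matrix (Fin n) (Fin n) ℂ) (ε : ℝ) : Set (Matrix (Fin n) (Fin n) ℂ) :=
  {B | √(∑ i, ∑ j, ‖B i j - M i j‖ ^ 2) < ε}

/-- The open ball `𝐁_ε(p)` for the Euclidean norm on `ℝ^k × ℂ`. -/
def pointBall (p : (Fin k → ℝ) × ℂ) (ε : ℝ) : Set ((Fin k → ℝ) × ℂ) :=
  {q | √((∑ i, (q.1 i - p.1 i) ^ 2) + ‖q.2 - p.2‖ ^ 2) < ε}

/-- Two points of `ES(S)` are paired in `S` if they lie in the same path component of `ES(S)`. -/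
def Paired (A : Fin k → Matrix (Fin n) (Fin n) ℂ) (S : Set (Matrix (Fin n) (Fin n) ℂ))
    (p q : (Fin k → ℝ) × ℂ) : Prop :=
  JoinedIn (ES A S) p q

/-- Let `p = (α, lam)` and let `M` be the matrix with coefficients `α`. The matrix `M` is locally
non-transitive about the eigenvalue `p` if for all small `ε > 0` and all
`B ∈ 𝐁_ε(M) ∩ 𝒞` (with coefficients `β`), any two eigenvalues of `B` that are paired with `p`
within the ball are paired with each other in `𝐁_ε(M) ∩ 𝒞`. -/
def LocallyNonTransitive (A : Fin k → Matrix (Fin n) (Fin n) ℂ) (p : (Fin k → ℝ) × ℂ) : Prop :=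
  ∃ ε₀ > 0, ∀ ε : ℝ, 0 < ε → ε < ε₀ → ∀ (β : Fin k → ℝ) (μ₁ μ₂ : ℂ),
    (β, μ₁) ∈ ES A (matrixBall (combo A p.1) ε ∩ core A) →
    (β, μ₂) ∈ ES A (matrixBall (combo A p.1) ε ∩ core A) →
    Paired A (matrixBall (combo A p.1) ε ∩ Co A) (β, μ₁) p →
    Paired A (matrixBall (combo A p.1) ε ∩ Co A) (β, μ₂) p →
    Paired A (matrixBall (combo A p.1) ε ∩ core A) (β, μ₁) (β, μ₂)

/-- `X` is a topological manifold, possibly with boundary, of some finite dimension: Hausdorff,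
second countable, with charts in a Euclidean space or in a Euclidean half-space. -/
def IsTopologicalManifold (X : Type) [TopologicalSpace X] : Prop :=
  T2Space X ∧ SecondCountableTopology X ∧ ∃ m : ℕ,
    Nonempty (ChartedSpace (EuclideanSpace ℝ (Fin m)) X) ∨
    Nonempty (ChartedSpace (EuclideanHalfSpace (m + 1)) X)

end EigenSurface

/-! The contrapositive is proved: if a neighbourhood X of p in the eigen-surface is a manifold,
possibly with boundary, then the matrix is locally non-transitive about p. By regularity the core
consists of the matrices with simple eigenvalues. Over it the eigen-surface is locally a graph over
the simplex, so X, once it contains a point over the core, has dimension at least k - 1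
(`le_finrank_of_mem_core`). The part Z of the surface over the non-core is closed in X and has
Hausdorff dimension at most k - 3, because eigenvalues of constant multiplicity depend locally
Lipschitz on the coefficients (`dimH_spectrum_le`). So Z has codimension at least two in X and does
not disconnect open connected sets (`isPreconnected_diff_preimage`). Two eigenvalues paired with p
lie in one open path component; deleting Z leaves it connected, hence path connected, and a path in
it runs over the core.

Two points need work. Charts are only homeomorphisms and do not respect Hausdorff dimension, so
non-separation cannot be checked inside a chart. Instead, the inverse of the embedding of a ball
into the ambient space is approximated by a C¹ map f. Then f(Z) still has codimension two and misses
a translated segment, which Brouwer's theorem pulls back to the ball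
(`isPreconnected_ball_diff_preimage`). Secondly, pairing takes place over a ball of matrices, whose
points of the surface may lie far from p, since coefficients need not be unique and other
eigenvalues exist. A continuous choice of coefficients and a circle free of eigenvalues bring the
paths close to p (`exists_localization`). -/

namespace EigenSurface

/-! ### Brouwer's theorem by the Milnor–Rogers volume argument -/

section Brouwer

open Metric MeasureTheory Module

variable {E : Type*} [NormedAddCommGroup E] [InnerProductSpace ℝ E] [FiniteDimensional ℝ E]

/-- `det (1 + t A)` is a polynomial in `t` of degree at most the dimension. -/
lemma det_one_add_eq_sum_lagrange (L : E →L[ℝ] E) (s : Finset ℝ) (hs : s.card = finrank ℝ E + 1) :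
    (1 + L).det = ∑ i ∈ s, (Lagrange.basis s id i).eval 1 * (1 + i • L).det := by
  classical
  let b := finBasis ℝ E
  let M : Matrix _ _ ℝ := LinearMap.toMatrix b b (L : E →ₗ[ℝ] E)
  let P : Polynomial ℝ :=
    ((Polynomial.X : Polynomial ℝ) • M.map Polynomial.C + (1 : Matrix _ _ ℝ).map Polynomial.C).det
  have hP : ∀ t : ℝ, P.eval t = (1 + t • L).det := by
    intro t
    have h1 : (1 + t • L).det = (1 + t • M).det := by
      rw [ContinuousLinearMap.det, ← LinearMap.det_toMatrix b]
      congr 1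
      have : ((1 + t • L : E →L[ℝ] E) : E →ₗ[ℝ] E) = 1 + t • (L : E →ₗ[ℝ] E) := rfl
      rw [this, map_add, map_smul, LinearMap.toMatrix_one]
    rw [h1]
    simp only [P, ← Polynomial.coe_evalRingHom, RingHom.map_det]
    congr 1
    ext i j
    simp [Matrix.one_apply, apply_ite, add_comm]
    exact mul_comm _ _
  have hdeg : P.degree < s.card := by
    refine lt_of_le_of_lt Polynomial.degree_le_natDegree ?_
    have := Polynomial.natDegree_det_X_add_C_le M 1
    simp only [Fintype.card_fin] at this
    rw [hs]
    exact_mod_cast Nat.lt_succ_of_le this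
  -- There is one more node than the degree bound, so interpolation at `s` is exact.
  have h := Lagrange.eq_interpolate (v := id) (s := s) (injOn_id _) hdeg
  have h1 := congrArg (Polynomial.eval 1) h
  rw [hP, one_smul, Lagrange.interpolate_apply, Polynomial.eval_finsetSum] at h1
  rw [h1]
  refine Finset.sum_congr rfl fun i _ => ?_
  simp [hP, mul_comm]

/-- A segment from inside to outside crosses the sphere, where `w` vanishes, and its inner piece is
no longer than the whole; so extension by zero keeps the constant `K`. -/
lemma lipschitzWith_ite_norm_le {V : Type*} [NormedAddCommGroup V] [NormedSpace ℝ V]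
    {w : V → V} {K : NNReal} {ρ : ℝ}
    (hw : LipschitzOnWith K w (closedBall 0 ρ)) (h0 : ∀ x, ‖x‖ = ρ → w x = 0) :
    LipschitzWith K fun x => if ‖x‖ ≤ ρ then w x else 0 := by
  have key : ∀ x y : V, ‖x‖ ≤ ρ → ρ < ‖y‖ → ‖w x‖ ≤ K * ‖x - y‖ := by
    intro x y hx hy
    have hc : ContinuousOn (fun t : ℝ => ‖AffineMap.lineMap x y t‖) (Icc 0 1) := by
      have : Continuous fun t : ℝ => (AffineMap.lineMap x y t : V) :=
        AffineMap.lineMap_continuous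
      fun_prop
    obtain ⟨t, ht, htρ⟩ := intermediate_value_Icc (zero_le_one (α := ℝ)) hc
      (show ρ ∈ Icc _ _ by simpa using ⟨hx, hy.le⟩)
    have htρ' : ‖(AffineMap.lineMap x y t : V)‖ = ρ := htρ
    set z : V := AffineMap.lineMap x y t
    have h1 := hw.norm_sub_le (show x ∈ closedBall (0 : V) ρ by simpa using hx)
      (show z ∈ closedBall (0 : V) ρ by simpa using htρ'.le)
    rw [h0 z htρ', sub_zero] at h1
    refine h1.trans (mul_le_mul_of_nonneg_left ?_ K.2)
    have : x - z = t • (x - y) := by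
      simp only [z, AffineMap.lineMap_apply_module]
      module
    rw [this, norm_smul, Real.norm_eq_abs, abs_of_nonneg ht.1]
    exact mul_le_of_le_one_left (norm_nonneg _) ht.2
  refine LipschitzWith.of_dist_le_mul fun x y => ?_
  rw [dist_eq_norm, dist_eq_norm]
  by_cases hx : ‖x‖ ≤ ρ <;> by_cases hy : ‖y‖ ≤ ρ
  · simpa [hx, hy] using hw.norm_sub_le (show x ∈ closedBall (0 : V) ρ by simpa using hx)
      (show y ∈ closedBall (0 : V) ρ by simpa using hy)
  · simpa [hx, hy] using key x y hx (not_le.1 hy)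
  · rw [norm_sub_rev x y]
    simpa [hx, hy] using key y x hy (not_le.1 hx)
  · simp only [hx, hy, if_false, sub_self, norm_zero]
    positivity

/-- A perturbation of the identity by a small multiple of a displacement vanishing on the sphere
maps the open ball bijectively onto itself. -/
lemma eventually_bijOn_ball {w : E → E} {ρ : ℝ} (hw : ContDiff ℝ 1 w)
    (h0 : ∀ x, ‖x‖ = ρ → w x = 0) :
    ∀ᶠ t in 𝓝[>] (0 : ℝ), BijOn (fun x => x + t • w x) (ball 0 ρ) (ball 0 ρ) := by
  obtain ⟨K, hK⟩ : ∃ K, LipschitzOnWith K w (closedBall 0 ρ) :=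
    hw.contDiffOn.exists_lipschitzOnWith one_ne_zero (convex_closedBall 0 ρ)
      (isCompact_closedBall 0 ρ)
  have hu := lipschitzWith_ite_norm_le hK h0
  set u : E → E := fun x => if ‖x‖ ≤ ρ then w x else 0 with hu_def
  have h1 : ∀ᶠ t : ℝ in 𝓝[>] 0, t * K < 1 := by
    have : Filter.Tendsto (fun t : ℝ => t * K) (𝓝[>] 0) (𝓝 (0 * K)) :=
      (Continuous.tendsto (by fun_prop) _).mono_left nhdsWithin_le_nhds
    rw [zero_mul] at this
    exact this.eventually_lt_const one_pos
  filter_upwards [h1, self_mem_nhdsWithin] with t ht ht0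
  have ht0' : (0 : ℝ) < t := ht0
  have hall : ∀ x y : E, ‖(t • u x) - t • u y‖ ≤ t * K * ‖x - y‖ := by
    intro x y
    rw [← smul_sub, norm_smul, Real.norm_eq_abs, abs_of_pos ht0', mul_assoc]
    exact mul_le_mul_of_nonneg_left (hu.norm_sub_le x y) ht0'.le
  -- The extended map is the identity plus a map of Lipschitz constant `t * K < 1`, hence a
  -- homeomorphism of the whole space. It fixes every point outside the ball, so it preserves the
  -- ball.
  have happ : ApproximatesLinearOn (fun x => x + t • u x)
      ((ContinuousLinearEquiv.refl ℝ E : E ≃L[ℝ] E) : E →L[ℝ] E) univ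
      (Real.toNNReal t * K) := by
    intro x _ y _
    have := hall x y
    simp only [NNReal.coe_mul, Real.coe_toNNReal t ht0'.le]
    convert this using 2
    simp only [ContinuousLinearEquiv.coe_refl, ContinuousLinearMap.coe_id', id]
    abel
  have hbij : Function.Bijective fun x : E => x + t • u x := by
    refine (happ.toHomeomorph _ ?_).bijective
    rcases subsingleton_or_nontrivial E with hE | hE
    · exact Or.inl hE
    · right
      rw [← NNReal.coe_lt_coe]
      simp [Real.coe_toNNReal t ht0'.le, ht]
  have hid : ∀ x ∈ (ball (0 : E) ρ)ᶜ, x + t • u x = x := by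
    intro x hx
    have hx' : ρ ≤ ‖x‖ := by simpa using hx
    rcases hx'.eq_or_lt with h | h
    · simp [u, h0 x h.symm]
    · simp [u, not_le.2 h]
  have himg : (fun x => x + t • u x) '' ball 0 ρ = ball 0 ρ := by
    have h2 : (fun x => x + t • u x) '' (ball (0 : E) ρ)ᶜ = (ball 0 ρ)ᶜ := by
      rw [image_congr hid, image_id']
    rw [image_compl_eq hbij] at h2
    exact compl_injective h2
  have hcongr : EqOn (fun x => x + t • u x) (fun x => x + t • w x) (ball 0 ρ) := by
    intro x hx
    have : ‖x‖ ≤ ρ := by simpa using (mem_ball_zero_iff.1 hx).le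
    simp [u, this]
  have : BijOn (fun x => x + t • u x) (ball 0 ρ) (ball 0 ρ) := by
    have := hbij.1.injOn.bijOn_image (s := ball (0 : E) ρ)
    rwa [himg] at this
  exact this.congr hcongr

/-- There is no continuously differentiable retraction of a ball onto its boundary sphere. -/
theorem not_contDiff_retraction_sphere {r : E → E} {ρ : ℝ} (hρ : 0 < ρ) (hr : ContDiff ℝ 1 r)
    (hnorm : ∀ x, ‖r x‖ = ρ) (hid : ∀ x, ‖x‖ = ρ → r x = x) : False := by
  borelize E
  let w : E → E := fun x => r x - x
  have hw : ContDiff ℝ 1 w := hr.sub contDiff_id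
  have hfd : Continuous (fderiv ℝ w) := hw.continuous_fderiv one_ne_zero
  have hw0 : ∀ x, ‖x‖ = ρ → w x = 0 := fun x hx => by simp [w, hid x hx]
  have hdet : Continuous fun q : ℝ × E => (1 + q.1 • fderiv ℝ w q.2).det :=
    ContinuousLinearMap.continuous_det.comp (by fun_prop)
  have hpos : ∀ᶠ t in 𝓝 (0 : ℝ), ∀ x ∈ closedBall (0 : E) ρ, 0 < (1 + t • fderiv ℝ w x).det := by
    refine (isCompact_closedBall (0 : E) ρ).eventually_forall_of_forall_eventually fun x _ => ?_
    refine (hdet.tendsto (0, x)).eventually_const_lt ?_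
    simp [ContinuousLinearMap.det]
  have hint : ∀ t : ℝ, IntegrableOn (fun x => (1 + t • fderiv ℝ w x).det) (ball 0 ρ) := by
    intro t
    refine IntegrableOn.mono_set ?_ ball_subset_closedBall
    refine ContinuousOn.integrableOn_compact (isCompact_closedBall 0 ρ) ?_
    exact (hdet.comp (by fun_prop : Continuous fun x : E => (t, x))).continuousOn
  -- For small `t > 0` the map `id + t • w` permutes the ball, so its Jacobian integrates to the
  -- volume. That integral is polynomial in `t`, so the same value persists at `t = 1`, where the
  -- map is `r`.
  have hvol : ∀ᶠ t in 𝓝[>] (0 : ℝ),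
      ∫ x in ball (0 : E) ρ, (1 + t • fderiv ℝ w x).det = volume.real (ball (0 : E) ρ) := by
    filter_upwards [eventually_bijOn_ball hw hw0, nhdsWithin_le_nhds hpos] with t ht htp
    have h1 := integral_image_eq_integral_abs_det_fderiv_smul (μ := volume)
      (f' := fun x => 1 + t • fderiv ℝ w x) (measurableSet_ball (x := (0 : E)) (ε := ρ))
      (fun x _ => ((hasFDerivAt_id x).add
        (((hw.differentiable one_ne_zero) x).hasFDerivAt.const_smul t)).hasFDerivWithinAt)
      ht.injOn (fun _ => (1 : ℝ))
    have himg : (id + t • w) '' ball (0 : E) ρ = ball 0 ρ := ht.image_eq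
    rw [himg] at h1
    have h2 : ∫ x in ball (0 : E) ρ, (1 : ℝ) = volume.real (ball (0 : E) ρ) := by
      simp only [integral_const, smul_eq_mul, mul_one, measureReal_restrict_apply_univ]
    rw [← h2, h1]
    refine setIntegral_congr_fun measurableSet_ball fun x hx => ?_
    simp [abs_of_pos (htp x (ball_subset_closedBall hx))]
  obtain ⟨δ, hδ, hδ'⟩ := (nhdsGT_basis (0 : ℝ)).eventually_iff.1 hvol
  -- Any `finrank + 1` distinct nodes inside `(0, δ)` serve; the shift by 2 keeps the first one
  -- below `δ`.
  let s : Finset ℝ := (Finset.range (finrank ℝ E + 1)).image fun i : ℕ => δ / (i + 2)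
  have hs : s.card = finrank ℝ E + 1 := by
    rw [Finset.card_image_of_injective, Finset.card_range]
    intro i j hij
    have hi : ((i : ℝ) + 2) ≠ 0 := by positivity
    have hj : ((j : ℝ) + 2) ≠ 0 := by positivity
    simp only at hij
    rw [div_eq_div_iff hi hj] at hij
    have := mul_left_cancel₀ hδ.ne' hij
    exact_mod_cast (by linarith : (i : ℝ) = j)
  have hsδ : ∀ t ∈ s, t ∈ Ioo 0 δ := by
    intro t ht
    obtain ⟨i, -, rfl⟩ := Finset.mem_image.1 ht
    refine ⟨by positivity, ?_⟩
    rw [div_lt_iff₀ (by positivity)]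
    nlinarith [(Nat.cast_nonneg i : (0 : ℝ) ≤ i)]
  have hsum : ∫ x in ball (0 : E) ρ, (1 + fderiv ℝ w x).det = volume.real (ball (0 : E) ρ) := by
    rw [funext fun x => det_one_add_eq_sum_lagrange (fderiv ℝ w x) s hs]
    rw [integral_finsetSum _ fun i _ => (hint i).const_mul _]
    have h3 : ∀ i ∈ s, ∫ x in ball (0 : E) ρ,
        (Lagrange.basis s id i).eval 1 * (1 + i • fderiv ℝ w x).det
        = (Lagrange.basis s id i).eval 1 * volume.real (ball (0 : E) ρ) := fun i hi => by
      rw [integral_const_mul, hδ' (hsδ i hi)]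
    rw [Finset.sum_congr rfl h3, ← Finset.sum_mul, ← Polynomial.eval_finsetSum,
      Lagrange.sum_basis (injOn_id _) (Finset.card_pos.1 (by omega))]
    simp
  have hzero : ∀ x, (1 + fderiv ℝ w x).det = 0 := by
    intro x
    have hrd : HasFDerivAt r (fderiv ℝ r x) x := (hr.differentiable one_ne_zero x).hasFDerivAt
    have h4 : (1 + fderiv ℝ w x) = fderiv ℝ r x := by
      have : fderiv ℝ w x = fderiv ℝ r x - 1 := (hrd.sub (hasFDerivAt_id x)).fderiv
      rw [this]; abel
    rw [h4]
    by_contra hne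
    -- Since `‖r‖` is constant, the derivative takes values orthogonal to `r x ≠ 0`; an invertible
    -- one would attain `r x` itself.
    have h5 : ∀ v, inner ℝ (r x) (fderiv ℝ r x v) = 0 := by
      intro v
      have h6 := (hrd.inner ℝ hrd)
      have h7 : (fun y => inner ℝ (r y) (r y)) = fun _ : E => ρ ^ 2 := by
        ext y; rw [real_inner_self_eq_norm_sq, hnorm]
      rw [h7] at h6
      have h8 := h6.unique (hasFDerivAt_const _ _)
      have h9 := congrArg (fun l : E →L[ℝ] ℝ => l v) h8
      simp only [ContinuousLinearMap.comp_apply, ContinuousLinearMap.prod_apply,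
        fderivInnerCLM_apply, zero_apply] at h9
      rw [real_inner_comm (r x)] at h9
      linarith
    have hu : IsUnit (LinearMap.det (fderiv ℝ r x : E →ₗ[ℝ] E)) := isUnit_iff_ne_zero.2 hne
    obtain ⟨v, hv⟩ := (LinearMap.equivOfIsUnitDet hu).surjective (r x)
    have h10 := h5 v
    have hv' : fderiv ℝ r x v = r x := by simpa using hv
    rw [hv', real_inner_self_eq_norm_sq, hnorm] at h10
    nlinarith
  simp only [hzero, integral_zero] at hsum
  have : 0 < volume.real (ball (0 : E) ρ) :=
    ENNReal.toReal_pos (measure_ball_pos volume _ hρ).ne' measure_ball_lt_top.ne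
  linarith

/-- A continuous vector field on a closed ball that points outward on the boundary sphere has a
zero; this is a form of the Brouwer fixed point theorem. -/
theorem exists_eq_zero_of_inner_pos {g : E → E} {c : E} {R : ℝ} (hR : 0 < R)
    (hg : ContinuousOn g (closedBall c R)) (hin : ∀ x ∈ sphere c R, 0 < inner ℝ (g x) (x - c)) :
    ∃ x ∈ closedBall c R, g x = 0 := by
  by_contra! hne
  let pr : E → E := fun x => (R / max R ‖x‖) • x
  have hmax : ∀ x : E, 0 < max R ‖x‖ := fun x => lt_max_of_lt_left hR
  have hpr : Continuous pr := by
    refine Continuous.smul (Continuous.div continuous_const (by fun_prop) fun x => (hmax x).ne')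
      continuous_id
  have hpr_norm : ∀ x, ‖pr x‖ ≤ R := by
    intro x
    simp only [pr, norm_smul, Real.norm_eq_abs]
    rw [abs_of_pos (div_pos hR (hmax x)), div_mul_eq_mul_div, div_le_iff₀ (hmax x)]
    exact mul_le_mul_of_nonneg_left (le_max_right _ _) hR.le
  let χ : E → ℝ := fun x => max 0 (min 1 (‖x‖ / R - 1))
  have hχ : Continuous χ := by fun_prop
  -- `H` is `g` on the ball, moved to the origin, and the identity beyond radius `2R`. In between it
  -- has positive inner product with `x`, so a zero-free `g` gives a zero-free `H`.
  let H : E → E := fun x => (1 - χ x) • g (c + pr x) + χ x • x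
  have hH : Continuous H := by
    have h1 : Continuous fun x => g (c + pr x) :=
      hg.comp_continuous (by fun_prop) fun x => by simpa using hpr_norm x
    exact ((continuous_const.sub hχ).smul h1).add (hχ.smul continuous_id)
  have hH0 : ∀ x, H x ≠ 0 := by
    intro x
    rcases le_or_gt ‖x‖ R with hx | hx
    · have h1 : χ x = 0 := by
        have : ‖x‖ / R - 1 ≤ 0 := by rw [sub_nonpos, div_le_one hR]; exact hx
        exact max_eq_left ((min_le_right _ _).trans this)
      have h2 : pr x = x := by simp [pr, max_eq_left hx, hR.ne']
      simp only [H, h1, h2, sub_zero, one_smul, zero_smul, add_zero]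
      exact hne _ (by simpa using hx)
    · intro h0
      have hx0 : 0 < ‖x‖ := hR.trans hx
      have h2 : pr x = (R / ‖x‖) • x := by simp [pr, max_eq_right hx.le]
      have h3 : 0 < inner ℝ (g (c + pr x)) x := by
        have h4 := hin (c + pr x) (by
          simp only [mem_sphere_iff_norm, add_sub_cancel_left, h2, norm_smul, Real.norm_eq_abs]
          rw [abs_of_pos (div_pos hR hx0), div_mul_cancel₀ _ hx0.ne'])
        rw [add_sub_cancel_left] at h4
        nth_rewrite 2 [h2] at h4
        rw [inner_smul_right] at h4
        exact pos_of_mul_pos_right h4 (div_pos hR hx0).le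
      have h5 : inner ℝ (H x) x = (1 - χ x) * inner ℝ (g (c + pr x)) x + χ x * ‖x‖ ^ 2 := by
        simp only [H, inner_add_left, real_inner_smul_left, real_inner_self_eq_norm_sq]
      rw [h0, inner_zero_left] at h5
      have h6 : 0 ≤ χ x := le_max_left _ _
      have h7 : χ x ≤ 1 := max_le zero_le_one (min_le_left _ _)
      have h8 : 0 < ‖x‖ ^ 2 := by positivity
      rcases h7.eq_or_lt with h | h
      · rw [h] at h5; linarith
      · have : 0 < (1 - χ x) * inner ℝ (g (c + pr x)) x := mul_pos (by linarith) h3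
        have : 0 ≤ χ x * ‖x‖ ^ 2 := by positivity
        linarith
  have hHid : ∀ x, 2 * R ≤ ‖x‖ → H x = x := by
    intro x hx
    have h1 : χ x = 1 := by
      have : 1 ≤ ‖x‖ / R - 1 := by
        rw [le_sub_iff_add_le, le_div_iff₀ hR]; linarith
      simp [χ, min_eq_left this]
    simp [H, h1]
  -- An error below `‖H x‖` keeps the smoothing zero-free, and it stays the identity from radius
  -- `3R` on; normalising it to length `3R` gives the forbidden retraction.
  obtain ⟨h, hh, happ, heq, -⟩ := hH.exists_contDiff_approx_and_eqOn 1
    (ε := fun x => ‖H x‖) (by fun_prop) (fun x => norm_pos_iff.2 (hH0 x))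
    (S := {x | 3 * R ≤ ‖x‖}) (U := {x | 2 * R < ‖x‖})
    (isClosed_le continuous_const continuous_norm)
    ((isOpen_lt continuous_const continuous_norm).mem_nhdsSet.2 fun x hx => by
      have : 3 * R ≤ ‖x‖ := hx
      show 2 * R < ‖x‖
      linarith)
    (contDiffOn_id.congr fun x hx => hHid x (le_of_lt hx))
  have hh0 : ∀ x, h x ≠ 0 := by
    intro x h0
    have := happ x
    rw [h0, dist_zero_left] at this
    exact lt_irrefl _ this
  refine not_contDiff_retraction_sphere (r := fun x => (3 * R / ‖h x‖) • h x) (ρ := 3 * R)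
    (by positivity) ?_ ?_ ?_
  · refine ContDiff.smul (ContDiff.div contDiff_const ?_ fun x => norm_ne_zero_iff.2 (hh0 x)) hh
    exact hh.norm ℝ hh0
  · intro x
    have := norm_pos_iff.2 (hh0 x)
    rw [norm_smul, Real.norm_eq_abs, abs_of_pos (by positivity), div_mul_cancel₀ _ this.ne']
  · intro x hx
    have : h x = x := by
      rw [heq (show x ∈ {x | 3 * R ≤ ‖x‖} from hx.ge), hHid x (by rw [hx]; linarith)]
    simp only [this, hx]
    rw [div_self (by positivity), one_smul]

end Brouwer

/-! ### Hausdorff dimension and topologically embedded balls -/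

section Dimension

open Metric Module

variable {E : Type*} [NormedAddCommGroup E] [InnerProductSpace ℝ E] [FiniteDimensional ℝ E]
  {F : Type*} [NormedAddCommGroup F] [NormedSpace ℝ F] [FiniteDimensional ℝ F]

/-- The inverse of a continuous injection of a compact set can be approximated by a continuously
differentiable map. -/
lemma exists_contDiff_approx_leftInverse {K : Set E} (hK : IsCompact K) {j : E → F}
    (hj : ContinuousOn j K) (hinj : InjOn j K) {η : ℝ} (hη : 0 < η) :
    ∃ f : F → E, ContDiff ℝ 1 f ∧ ∀ x ∈ K, ‖f (j x) - x‖ < η := by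
  have : CompactSpace K := isCompact_iff_compactSpace.1 hK
  have hcont : Continuous (K.domRestrict j) := continuousOn_iff_continuous_domRestrict.1 hj
  have hemb : IsClosedEmbedding (K.domRestrict j) :=
    hcont.isClosedEmbedding (injOn_iff_injective.1 hinj)
  -- Tietze extends the inverse from the compact image to all of `F`; smoothing the extension costs
  -- at most `η`.
  obtain ⟨G, hG⟩ := ContinuousMap.exists_extension hemb
    (⟨Subtype.val, continuous_subtype_val⟩ : C(K, E))
  obtain ⟨f, hf, hfG, -⟩ := G.continuous.exists_contDiff_approx 1 (ε := fun _ => η)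
    continuous_const fun _ => hη
  refine ⟨f, hf, fun x hx => ?_⟩
  have h1 : G (j x) = x := congrArg (fun g : C(K, E) => g ⟨x, hx⟩) hG
  have h2 := hfG (j x)
  rwa [h1, dist_eq_norm] at h2

/-- The outward condition for Brouwer: `y` is almost the boundary point `x`, `s` is a target well
inside, and the main term `R ^ 2` beats the errors `(η + r) * R`. -/
lemma inner_sub_pos_of_norm_lt {V : Type*} [NormedAddCommGroup V] [InnerProductSpace ℝ V]
    {x y s c : V} {η r R : ℝ} (hR : 0 < R) (hy : ‖y - x‖ ≤ η)
    (hs : ‖s - c‖ ≤ r) (hx : ‖x - c‖ = R) (h : η + r < R) : 0 < inner ℝ (y - s) (x - c) := by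
  have h1 : y - s = (x - c) + (y - x) - (s - c) := by abel
  rw [h1, inner_sub_left, inner_add_left, real_inner_self_eq_norm_sq, hx]
  have h2 := (abs_le.1 (abs_real_inner_le_norm (y - x) (x - c))).1
  have h3 := (abs_le.1 (abs_real_inner_le_norm (s - c) (x - c))).2
  rw [hx] at h2 h3
  nlinarith

lemma dimH_image_le_of_contDiff {V : Type*} [NormedAddCommGroup V] [NormedSpace ℝ V] {f : F → V}
    (hf : ContDiff ℝ 1 f) (s : Set F) :
    dimH (f '' s) ≤ dimH s :=
  hf.contDiffOn.dimH_image_le convex_univ (subset_univ s)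

/-- A topologically embedded closed ball has at least its linear dimension as Hausdorff
dimension. -/
theorem finrank_le_dimH_image_closedBall {c : E} {R : ℝ} (hR : 0 < R) {j : E → F}
    (hj : ContinuousOn j (closedBall c R)) (hinj : InjOn j (closedBall c R)) :
    (finrank ℝ E : ℝ≥0∞) ≤ dimH (j '' closedBall c R) := by
  by_contra! hlt
  obtain ⟨f, hf, hfj⟩ := exists_contDiff_approx_leftInverse (isCompact_closedBall c R) hj hinj
    (half_pos hR)
  -- An image of dimension below that of `E` misses some `v` near the centre. But `f ∘ j` is close
  -- to the identity, so Brouwer forces it to take the value `v`.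
  have hd : Dense (f '' (j '' closedBall c R))ᶜ :=
    dense_compl_of_dimH_lt_finrank ((dimH_image_le_of_contDiff hf _).trans_lt hlt)
  obtain ⟨v, hv, hvc⟩ := hd.exists_mem_open isOpen_ball ⟨c, mem_ball_self (by positivity : 0 < R / 4)⟩
  obtain ⟨x, hx, hx0⟩ := exists_eq_zero_of_inner_pos (g := fun x => f (j x) - v) hR
    ((hf.continuous.comp_continuousOn hj).sub continuousOn_const) fun x hx => by
      rw [mem_sphere_iff_norm] at hx
      refine inner_sub_pos_of_norm_lt hR (hfj x ?_).le (mem_ball_iff_norm.1 hvc).le hx (by linarith)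
      simp [dist_eq_norm, hx]
  exact hv ⟨j x, ⟨x, hx, rfl⟩, sub_eq_zero.1 hx0⟩

/-- A set of codimension at least two is missed by arbitrarily small translates of a segment. -/
lemma exists_translate_segment_disjoint {S : Set E} (hS : dimH S + 2 ≤ finrank ℝ E) {a b : E}
    (hab : a ≠ b) {η : ℝ} (hη : 0 < η) :
    ∃ v : E, ‖v‖ < η ∧ ∀ t : ℝ, (a + v) + t • (b - a) ∉ S := by
  -- Lines in direction `b - a` are the fibres of the projection onto `U`. The shadow of `S` has
  -- dimension below that of `U`, so some fibre close to the one through `a` misses `S`.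
  set U : Submodule ℝ E := (ℝ ∙ (b - a))ᗮ with hU
  have hfin : finrank ℝ U + 1 = finrank ℝ E := by
    rw [← Submodule.finrank_add_finrank_orthogonal (ℝ ∙ (b - a)),
      finrank_span_singleton (sub_ne_zero.2 hab.symm), add_comm]
  have hlt : dimH (U.orthogonalProjectionOnto '' S) < finrank ℝ U := by
    have h1 : dimH (U.orthogonalProjectionOnto '' S) ≤ dimH S :=
      U.orthogonalProjectionOnto.lipschitz.dimH_image_le S
    have h2 : dimH S + 1 + 1 ≤ (finrank ℝ U : ℝ≥0∞) + 1 := by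
      rw [add_assoc, one_add_one_eq_two]
      exact_mod_cast hfin ▸ hS
    have h3 : dimH S + 1 ≤ finrank ℝ U := (ENNReal.add_le_add_iff_right ENNReal.one_ne_top).1 h2
    have h4 : dimH S ≠ ∞ := by
      intro h
      simp [h] at h3
    exact h1.trans_lt ((ENNReal.lt_add_right h4 one_ne_zero).trans_le h3)
  obtain ⟨w, hw, hwa⟩ := (dense_compl_of_dimH_lt_finrank hlt).exists_mem_open isOpen_ball
    ⟨U.orthogonalProjectionOnto a, mem_ball_self hη⟩
  refine ⟨(w - U.orthogonalProjectionOnto a : U), ?_, fun t ht => hw ⟨_, ht, ?_⟩⟩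
  · rw [← Submodule.coe_norm]
    exact mem_ball_iff_norm.1 hwa
  · have h5 : U.orthogonalProjectionOnto (b - a) = 0 :=
      Submodule.orthogonalProjectionOnto_orthogonal_apply_eq_zero (Submodule.mem_span_singleton_self _)
    rw [map_add, map_add, map_smul, h5, smul_zero, add_zero,
      Submodule.orthogonalProjectionOnto_mem_subspace_eq_self]
    abel

/-- A relatively closed set whose image under an embedding has Hausdorff codimension at least two
does not separate a ball. -/
theorem isPreconnected_ball_diff_preimage {c : E} {R : ℝ} {j : E → F}
    (hj : ContinuousOn j (ball c R)) (hinj : InjOn j (ball c R)) {Z : Set F}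
    (hZ : dimH Z + 2 ≤ finrank ℝ E) (hopen : IsOpen (ball c R \ j ⁻¹' Z)) :
    IsPreconnected (ball c R \ j ⁻¹' Z) := by
  set S := ball c R \ j ⁻¹' Z with hS
  rintro V₁ V₂ hV₁ hV₂ hcov ⟨a, haS, ha⟩ ⟨b, hbS, hb⟩
  by_contra hdisj
  rw [not_nonempty_iff_eq_empty] at hdisj
  have hd : ∀ x ∈ S, x ∈ V₁ → x ∈ V₂ → False := fun x hx h1 h2 =>
    (hdisj ▸ (⟨hx, h1, h2⟩ : x ∈ S ∩ (V₁ ∩ V₂)) : x ∈ (∅ : Set E))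
  obtain ⟨ρ₁, hρ₁, hρ₁'⟩ := Metric.isOpen_iff.1 (hV₁.inter hopen) a ⟨ha, haS⟩
  obtain ⟨ρ₂, hρ₂, hρ₂'⟩ := Metric.isOpen_iff.1 (hV₂.inter hopen) b ⟨hb, hbS⟩
  have haR : ‖a - c‖ < R := mem_ball_iff_norm.1 haS.1
  have hbR : ‖b - c‖ < R := mem_ball_iff_norm.1 hbS.1
  obtain ⟨r, hr, hrR⟩ := exists_between (max_lt haR hbR)
  obtain ⟨R', hrR', hR'R⟩ := exists_between hrR
  have har : ‖a - c‖ < r := (le_max_left _ _).trans_lt hr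
  have hbr : ‖b - c‖ < r := (le_max_right _ _).trans_lt hr
  have hr0 : 0 < r := (norm_nonneg _).trans_lt har
  have hR' : 0 < R' := hr0.trans hrR'
  -- The bounds by `ρ₁ / 2` and `ρ₂ / 2` put points `2η`-close to `a` or `b` on the correct side;
  -- the bound by `(R' - r) / 2` gives `η + (r + η) < R'`, as the outward condition requires.
  obtain ⟨η, hη, hη'⟩ := exists_between
    (show 0 < min (min (ρ₁ / 2) (ρ₂ / 2)) ((R' - r) / 2) from
      lt_min (lt_min (by positivity) (by positivity)) (by linarith))
  have hηρ₁ : η < ρ₁ / 2 := hη'.trans_le ((min_le_left _ _).trans (min_le_left _ _))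
  have hηρ₂ : η < ρ₂ / 2 := hη'.trans_le ((min_le_left _ _).trans (min_le_right _ _))
  have hηR : η < (R' - r) / 2 := hη'.trans_le (min_le_right _ _)
  have hsub : closedBall c R' ⊆ ball c R := closedBall_subset_ball hR'R
  obtain ⟨f, hf, hfj⟩ := exists_contDiff_approx_leftInverse (isCompact_closedBall c R')
    (hj.mono hsub) (hinj.mono hsub) hη
  have hcont : ContinuousOn (fun x => f (j x)) (closedBall c R') :=
    hf.continuous.comp_continuousOn (hj.mono hsub)
  have hab : a ≠ b := fun h => hd a haS ha (h ▸ hb)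
  have hdim : dimH (f '' Z) + 2 ≤ finrank ℝ E :=
    (add_le_add_left (dimH_image_le_of_contDiff hf Z) 2).trans hZ
  obtain ⟨v, hv, hvS⟩ := exists_translate_segment_disjoint hdim hab hη
  let seg : ℝ → E := fun t => (a + v) + t • (b - a)
  have hseg : Continuous seg := by fun_prop
  -- `T` consists of the points that `f ∘ j` sends into the translated segment; it avoids `j ⁻¹' Z`
  -- because the segment avoids `f '' Z`.
  let T : Set E := closedBall c R' ∩ (fun x => f (j x)) ⁻¹' (seg '' Icc 0 1)
  have hT : IsClosed T :=
    hcont.preimage_isClosed_of_isClosed isClosed_closedBall (isCompact_Icc.image hseg).isClosed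
  have hTS : T ⊆ S := by
    rintro x ⟨hx, t, -, ht⟩
    exact ⟨hsub hx, fun hxZ => hvS t (by rw [show a + v + t • (b - a) = f (j x) from ht]; exact ⟨_, hxZ, rfl⟩)⟩
  have hT₁ : IsClosed (T \ (V₁ ∩ S)) := hT.sdiff (hV₁.inter hopen)
  have hT₂ : IsClosed (T \ (V₂ ∩ S)) := hT.sdiff (hV₂.inter hopen)
  have hTd : Disjoint (T \ (V₁ ∩ S)) (T \ (V₂ ∩ S)) := by
    rw [disjoint_left]
    rintro x ⟨hxT, hx1⟩ ⟨-, hx2⟩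
    rcases hcov (hTS hxT) with h | h
    · exact hx1 ⟨h, hTS hxT⟩
    · exact hx2 ⟨h, hTS hxT⟩
  -- The Urysohn function is crossed on purpose: on `T` it is 0, the end near `a ∈ V₁`, on the `V₂`
  -- part, and 1, the end near `b ∈ V₂`, on the `V₁` part. A solution of `f (j x) = seg (t x)` then
  -- lies on the wrong side.
  obtain ⟨t, ht0, ht1, ht⟩ := exists_continuous_zero_one_of_isClosed hT₁ hT₂ hTd
  have hsegc : ∀ s ∈ Icc (0 : ℝ) 1, ‖seg s - c‖ ≤ r + η := by
    intro s hs
    have h1 : seg s - c = ((1 - s) • (a - c) + s • (b - c)) + v := by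
      simp only [seg]; module
    rw [h1]
    refine (norm_add_le _ _).trans (add_le_add ?_ hv.le)
    refine (norm_add_le _ _).trans ?_
    rw [norm_smul, norm_smul, Real.norm_eq_abs, Real.norm_eq_abs, abs_of_nonneg hs.1,
      abs_of_nonneg (sub_nonneg.2 hs.2)]
    nlinarith [hs.1, hs.2]
  obtain ⟨x, hx, hx0⟩ := exists_eq_zero_of_inner_pos (g := fun x => f (j x) - seg (t x)) hR'
    (hcont.sub (hseg.comp t.continuous).continuousOn) fun x hx => by
      rw [mem_sphere_iff_norm] at hx
      refine inner_sub_pos_of_norm_lt hR' (hfj x ?_).le (hsegc _ (ht x)) hx (by linarith)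
      simp [dist_eq_norm, hx]
  have hx1 : f (j x) = seg (t x) := sub_eq_zero.1 hx0
  have hxT : x ∈ T := ⟨hx, t x, ht x, hx1.symm⟩
  have hnear : ∀ y, f (j x) = y + v → ‖x - y‖ < 2 * η := by
    intro y hy
    have h1 : x - y = -(f (j x) - x) + v := by rw [hy]; abel
    rw [h1]
    refine (norm_add_le _ _).trans_lt ?_
    rw [norm_neg]
    linarith [hfj x hx]
  by_cases h2 : x ∈ V₂ ∩ S
  · have h3 : t x = 0 := ht0 ⟨hxT, fun h => hd x h.2 h.1 h2.1⟩
    have h4 : x ∈ ball a ρ₁ := by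
      rw [mem_ball_iff_norm]
      refine (hnear a ?_).trans (by linarith)
      rw [hx1, h3]
      simp [seg]
    exact hd x (hρ₁' h4).2 (hρ₁' h4).1 h2.1
  · have h3 : t x = 1 := ht1 ⟨hxT, h2⟩
    have h4 : x ∈ ball b ρ₂ := by
      rw [mem_ball_iff_norm]
      refine (hnear b ?_).trans (by linarith)
      rw [hx1, h3]
      simp only [seg]
      module
    exact h2 (hρ₂' h4)

end Dimension

/-! ### Codimension two sets in manifolds with boundary -/

section Manifold

open Metric Module

/-- Removing a closed nowhere dense set that does not separate locally does not disconnect an open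
connected set. -/
lemma isPreconnected_diff_of_locally {X : Type*} [TopologicalSpace X] {C D : Set X}
    (hC : IsPreconnected C) (hloc : ∀ x ∈ C, ∃ N ∈ 𝓝 x, N ⊆ C ∧ IsPreconnected (N \ D))
    (hD : ∀ x ∈ C, ∀ N ∈ 𝓝 x, (N \ D).Nonempty) : IsPreconnected (C \ D) := by
  rw [isPreconnected_iff_subset_of_disjoint]
  intro V₁ V₂ hV₁ hV₂ hcov hdisj
  -- A separation of `C \ D` spreads to `C`: each point goes to the side containing a punctured
  -- neighbourhood of it. The two sides are disjoint because `D` contains no neighbourhood.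
  let O : Set X → Set X := fun V => {x | ∃ N ∈ 𝓝 x, N ⊆ C ∧ N \ D ⊆ V}
  have hO : ∀ V, IsOpen (O V) := by
    intro V
    rw [isOpen_iff_mem_nhds]
    rintro x ⟨N, hN, hNC, hNV⟩
    filter_upwards [eventually_mem_nhds_iff.2 hN] with y hy
    exact ⟨N, hy, hNC, hNV⟩
  have hcovO : C ⊆ O V₁ ∪ O V₂ := by
    intro x hx
    obtain ⟨N, hN, hNC, hNp⟩ := hloc x hx
    have hsub : N \ D ⊆ C \ D := sdiff_subset_sdiff_left hNC
    rcases isPreconnected_iff_subset_of_disjoint.1 hNp V₁ V₂ hV₁ hV₂ (hsub.trans hcov)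
      (subset_empty_iff.1 (hdisj ▸ inter_subset_inter_left _ hsub)) with h | h
    · exact Or.inl ⟨N, hN, hNC, h⟩
    · exact Or.inr ⟨N, hN, hNC, h⟩
  have hdisjO : C ∩ (O V₁ ∩ O V₂) = ∅ := by
    rw [eq_empty_iff_forall_notMem]
    rintro x ⟨hx, ⟨N₁, hN₁, hC₁, h₁⟩, N₂, hN₂, -, h₂⟩
    obtain ⟨y, hy, hyD⟩ := hD x hx _ (Filter.inter_mem hN₁ hN₂)
    have : y ∈ C \ D ∩ (V₁ ∩ V₂) := ⟨⟨hC₁ hy.1, hyD⟩, h₁ ⟨hy.1, hyD⟩, h₂ ⟨hy.2, hyD⟩⟩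
    rwa [hdisj] at this
  have hfin : ∀ V, C ⊆ O V → C \ D ⊆ V := by
    rintro V hV x ⟨hx, hxD⟩
    obtain ⟨N, hN, -, hNV⟩ := hV hx
    exact hNV ⟨mem_of_mem_nhds hN, hxD⟩
  exact (isPreconnected_iff_subset_of_disjoint.1 hC _ _ (hO V₁) (hO V₂) hcovO hdisjO).imp
    (hfin _) (hfin _)

variable {E : Type*} [NormedAddCommGroup E] [InnerProductSpace ℝ E] [FiniteDimensional ℝ E]
  {F : Type*} [NormedAddCommGroup F] [NormedSpace ℝ F] [FiniteDimensional ℝ F]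
  {H : Type*} [TopologicalSpace H] {X : Type*} [TopologicalSpace X] {i : X → F}

/-- Otherwise `Z` would contain an embedded closed ball, whose Hausdorff dimension is at least
`finrank ℝ E`. -/
lemma not_subset_preimage_of_dimH {C : Set E} (hC : IsOpen C) (hne : C.Nonempty) {j : E → F}
    (hj : ContinuousOn j C) (hinj : InjOn j C) {Z : Set F} (hZ : dimH Z + 2 ≤ finrank ℝ E) :
    ∃ x ∈ C, j x ∉ Z := by
  by_contra! hsub
  obtain ⟨x, hx⟩ := hne
  obtain ⟨r, hr, hrC⟩ := nhds_basis_closedBall.mem_iff.1 (hC.mem_nhds hx)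
  have h1 := finrank_le_dimH_image_closedBall hr (hj.mono hrC) (hinj.mono hrC)
  have h2 : dimH (j '' closedBall x r) ≤ dimH Z :=
    dimH_mono (image_subset_iff.2 fun y hy => hsub y (hrC hy))
  have h3 := hZ.trans (h1.trans h2)
  have h4 : dimH Z ≠ ∞ := fun h => by simp [h] at hZ
  exact absurd h3 (not_le.2 (ENNReal.lt_add_right h4 two_ne_zero))

/-- Sets of codimension at least two do not separate small neighbourhoods in a manifold, possibly
with boundary, and have empty interior. -/
lemma exists_nhds_isPreconnected_diff (I : ModelWithCorners ℝ E H) [ChartedSpace H X]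
    (hi : Continuous i) (hinj : Function.Injective i) {Z : Set F}
    (hZ : dimH Z + 2 ≤ finrank ℝ E) (hcl : IsClosed (i ⁻¹' Z)) {x : X} {W : Set X} (hW : W ∈ 𝓝 x) :
    ∃ N ∈ 𝓝 x, N ⊆ W ∧ IsPreconnected (N \ i ⁻¹' Z) ∧ (N \ i ⁻¹' Z).Nonempty := by
  set φ := extChartAt I x with hφ
  have h1 : φ.symm ⁻¹' W ∩ φ.target ∈ 𝓝[range I] (φ x) := by
    refine Filter.inter_mem ?_ (extChartAt_target_mem_nhdsWithin x)
    have := extChartAt_preimage_mem_nhdsWithin (I := I) (s := univ) (t := W) (x := x)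
      (by rwa [nhdsWithin_univ])
    rwa [preimage_univ, univ_inter] at this
  obtain ⟨r, hr, hrW⟩ := Metric.mem_nhdsWithin_iff.1 h1
  set Q := ball (φ x) r ∩ range I with hQ
  -- At a boundary point `Q` is only part of a ball. The argument for full balls runs in the open
  -- convex set `Q'`, which is dense in `Q`.
  set Q' := ball (φ x) r ∩ interior (range I) with hQ'
  have hQ'Q : Q' ⊆ Q := inter_subset_inter_right _ interior_subset
  have hQt : Q ⊆ φ.target := fun y hy => (hrW hy).2
  have hsymm : ContinuousOn φ.symm Q := (continuousOn_extChartAt_symm x).mono hQt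
  let j : E → F := fun y => i (φ.symm y)
  have hj : ContinuousOn j Q := hi.comp_continuousOn hsymm
  have hjinj : InjOn j Q := fun y hy z hz h => φ.symm.injOn (hQt hy) (hQt hz) (hinj h)
  have hQ'o : IsOpen Q' := isOpen_ball.inter isOpen_interior
  have hdense : ∀ y ∈ Q, ∀ G, IsOpen G → y ∈ G → (G ∩ Q').Nonempty := by
    intro y hy G hG hyG
    have h2 : y ∈ closure (interior (range I)) := I.range_subset_closure_interior hy.2
    obtain ⟨z, hz, hz'⟩ := mem_closure_iff.1 h2 _ (hG.inter isOpen_ball) ⟨hyG, hy.1⟩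
    exact ⟨z, hz.1, hz.2, hz'⟩
  have hdiff : ∀ y ∈ Q \ j ⁻¹' Z, ∃ G, IsOpen G ∧ y ∈ G ∧ G ∩ Q ⊆ (j ⁻¹' Z)ᶜ := by
    intro y hy
    have h2 : φ.symm ⁻¹' (i ⁻¹' Z)ᶜ ∈ 𝓝[Q] y :=
      hsymm y hy.1 (hcl.isOpen_compl.mem_nhds hy.2)
    obtain ⟨G, hG, hyG, hGs⟩ := mem_nhdsWithin.1 h2
    exact ⟨G, hG, hyG, hGs⟩
  have hopenS : ∀ C ⊆ Q', IsOpen C → IsOpen (C \ j ⁻¹' Z) := by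
    intro C hC hCo
    rw [isOpen_iff_mem_nhds]
    intro y hy
    obtain ⟨G, hG, hyG, hGs⟩ := hdiff y ⟨hQ'Q (hC hy.1), hy.2⟩
    filter_upwards [(hG.inter hCo).mem_nhds ⟨hyG, hy.1⟩] with z hz
    exact ⟨hz.2, hGs ⟨hz.1, hQ'Q (hC hz.2)⟩⟩
  have hne : (Q' \ j ⁻¹' Z).Nonempty := by
    have h2 : Q'.Nonempty := by
      obtain ⟨z, -, hz⟩ := hdense (φ x) ⟨mem_ball_self hr, by simp [hφ, extChartAt]⟩ univ isOpen_univ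
        (mem_univ _)
      exact ⟨z, hz⟩
    obtain ⟨z, hz, hz'⟩ := not_subset_preimage_of_dimH hQ'o h2 (hj.mono hQ'Q) (hjinj.mono hQ'Q) hZ
    exact ⟨z, hz, hz'⟩
  have hpre' : IsPreconnected (Q' \ j ⁻¹' Z) := by
    refine isPreconnected_diff_of_locally
      ((convex_ball _ _).inter I.convex_range.interior).isPreconnected ?_ ?_
    · intro y hy
      obtain ⟨s, hs, hsQ⟩ := Metric.isOpen_iff.1 hQ'o y hy
      exact ⟨ball y s, ball_mem_nhds _ hs, hsQ, isPreconnected_ball_diff_preimage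
        (hj.mono (hsQ.trans hQ'Q)) (hjinj.mono (hsQ.trans hQ'Q)) hZ (hopenS _ hsQ isOpen_ball)⟩
    · intro y hy N hN
      have hsub : interior N ∩ Q' ⊆ Q := inter_subset_right.trans hQ'Q
      obtain ⟨z, hz, hz'⟩ := not_subset_preimage_of_dimH (isOpen_interior.inter hQ'o)
        ⟨y, mem_interior_iff_mem_nhds.2 hN, hy⟩ (hj.mono hsub) (hjinj.mono hsub) hZ
      exact ⟨z, interior_subset hz.1, hz'⟩
  -- Boundary points of the model add only limits of `Q' \ j ⁻¹' Z`, which does not affect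
  -- preconnectedness.
  have hpre : IsPreconnected (Q \ j ⁻¹' Z) := by
    refine hpre'.subset_closure (sdiff_subset_sdiff_left hQ'Q) fun y hy => ?_
    rw [_root_.mem_closure_iff]
    intro G hG hyG
    obtain ⟨G', hG', hyG', hGs⟩ := hdiff y hy
    obtain ⟨z, hz, hzQ⟩ := hdense y hy.1 _ (hG.inter hG') ⟨hyG, hyG'⟩
    exact ⟨z, hz.1, hzQ, hGs ⟨hz.2, hQ'Q hzQ⟩⟩
  have himg : (φ.symm '' Q) \ i ⁻¹' Z = φ.symm '' (Q \ j ⁻¹' Z) := by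
    ext z
    constructor
    · rintro ⟨⟨y, hy, rfl⟩, hz⟩
      exact ⟨y, ⟨hy, hz⟩, rfl⟩
    · rintro ⟨y, ⟨hy, hz⟩, rfl⟩
      exact ⟨⟨y, hy, rfl⟩, hz⟩
  refine ⟨φ.symm '' Q, ?_, ?_, ?_, ?_⟩
  · filter_upwards [extChartAt_source_mem_nhds (I := I) x,
      (continuousAt_extChartAt (I := I) x).preimage_mem_nhds (ball_mem_nhds _ hr)] with z hz hz'
    exact ⟨φ z, ⟨hz', by simp [hφ, extChartAt]⟩, φ.left_inv hz⟩
  · rintro - ⟨y, hy, rfl⟩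
    exact (hrW hy).1
  · rw [himg]
    exact hpre.image _ (hsymm.mono sdiff_subset)
  · rw [himg]
    exact (hne.mono (sdiff_subset_sdiff_left hQ'Q)).image _

/-- A closed set of Hausdorff codimension at least two does not disconnect an open connected subset
of a manifold, possibly with boundary. -/
theorem isPreconnected_diff_preimage (I : ModelWithCorners ℝ E H) [ChartedSpace H X]
    (hi : Continuous i) (hinj : Function.Injective i) {Z : Set F}
    (hZ : dimH Z + 2 ≤ finrank ℝ E) (hcl : IsClosed (i ⁻¹' Z)) {C : Set X} (hCo : IsOpen C)
    (hC : IsPreconnected C) : IsPreconnected (C \ i ⁻¹' Z) := by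
  refine isPreconnected_diff_of_locally hC (fun x hx => ?_) fun x hx N hN => ?_
  · obtain ⟨N, hN, hNC, hNp, -⟩ :=
      exists_nhds_isPreconnected_diff I hi hinj hZ hcl (hCo.mem_nhds hx)
    exact ⟨N, hN, hNC, hNp⟩
  · obtain ⟨N', -, hN'N, -, hne⟩ := exists_nhds_isPreconnected_diff I hi hinj hZ hcl hN
    exact hne.mono (sdiff_subset_sdiff_left hN'N)

/-- Invariance of dimension, in the form of an inequality: a ball embedded in a manifold has at most
the dimension of the manifold. -/
theorem finrank_le_of_embedding_ball (I : ModelWithCorners ℝ E H) [ChartedSpace H X]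
    {G : Type*} [NormedAddCommGroup G] [InnerProductSpace ℝ G]
    [FiniteDimensional ℝ G] {s : Set G} (hs : s ∈ 𝓝 (0 : G)) {h : G → X} (hh : ContinuousOn h s)
    (hinj : InjOn h s) : finrank ℝ G ≤ finrank ℝ E := by
  set φ := extChartAt I (h 0)
  have h0 : ContinuousAt h 0 := hh.continuousAt hs
  obtain ⟨r, hr, hrs⟩ := nhds_basis_closedBall.mem_iff.1
    (Filter.inter_mem hs (h0.preimage_mem_nhds (extChartAt_source_mem_nhds (I := I) (h 0))))
  have h1 : ContinuousOn (fun y => φ (h y)) (closedBall 0 r) :=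
    (continuousOn_extChartAt (h 0)).comp (hh.mono fun y hy => (hrs hy).1) fun y hy => (hrs hy).2
  have h2 : InjOn (fun y => φ (h y)) (closedBall 0 r) := fun y hy z hz hyz =>
    hinj (hrs hy).1 (hrs hz).1 (φ.injOn (hrs hy).2 (hrs hz).2 hyz)
  have h3 := (finrank_le_dimH_image_closedBall hr h1 h2).trans (dimH_mono (subset_univ _))
  rw [Real.dimH_univ_eq_finrank] at h3
  exact_mod_cast h3

end Manifold

variable {n k : ℕ}

/-! ### Eigenvalues as functions of the coefficients -/

section Charpoly

open Polynomial

lemma continuous_combo (A : Fin k → Matrix (Fin n) (Fin n) ℂ) : Continuous (combo A) := by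
  unfold combo
  fun_prop

/-- The `r`-th derivative of the characteristic polynomial of `combo A α`, evaluated at `x`. -/
noncomputable def derivCharpoly (A : Fin k → Matrix (Fin n) (Fin n) ℂ) (r : ℕ)
    (q : (Fin k → ℝ) × ℂ) : ℂ :=
  (derivative^[r] (combo A q.1).charpoly).eval q.2

/-- In the eigenvalue variable the function is a complex polynomial, so its partial derivative is
multiplication by a number. This drives the induction for smoothness and supplies the invertibility
for the implicit function theorem. -/
lemma fderiv_derivCharpoly_apply (A : Fin k → Matrix (Fin n) (Fin n) ℂ) (r : ℕ)
    (q : (Fin k → ℝ) × ℂ) (h : DifferentiableAt ℝ (derivCharpoly A r) q) (w : ℂ) :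
    fderiv ℝ (derivCharpoly A r) q (0, w) = w * derivCharpoly A (r + 1) q := by
  have h1 : HasFDerivAt (fun x : ℂ => ((q.1, x) : (Fin k → ℝ) × ℂ))
      (ContinuousLinearMap.inr ℝ (Fin k → ℝ) ℂ) q.2 := hasFDerivAt_prodMk_right q.1 q.2
  have h2 : HasFDerivAt (fun x : ℂ => derivCharpoly A r (q.1, x)) _ q.2 :=
    HasFDerivAt.comp (g := derivCharpoly A r) q.2 h.hasFDerivAt h1
  have h3 : HasFDerivAt (fun x : ℂ => derivCharpoly A r (q.1, x)) _ q.2 :=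
    ((derivative^[r] (combo A q.1).charpoly).hasDerivAt q.2).hasFDerivAt.restrictScalars ℝ
  have h4 := congrArg (fun L : ℂ →L[ℝ] ℂ => L w) (h2.unique h3)
  simp only [ContinuousLinearMap.comp_apply, ContinuousLinearMap.inr_apply] at h4
  rw [h4, derivCharpoly, Function.iterate_succ_apply']
  simp

lemma contDiff_derivCharpoly (A : Fin k → Matrix (Fin n) (Fin n) ℂ) (r : ℕ) :
    ContDiff ℝ (⊤ : ℕ∞) (derivCharpoly A r) := by
  induction r with
  | zero =>
    have h : derivCharpoly A 0 = fun q => ∑ σ : Equiv.Perm (Fin n), Equiv.Perm.sign σ •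
        ∏ i, ((if σ i = i then q.2 else 0) - ∑ l, q.1 l • A l (σ i) i) := by
      ext q
      simp only [derivCharpoly, Function.iterate_zero, id, Matrix.eval_charpoly, Matrix.det_apply]
      refine Finset.sum_congr rfl fun σ _ => ?_
      congr 1
      refine Finset.prod_congr rfl fun i _ => ?_
      simp [combo, Matrix.sum_apply, Matrix.diagonal_apply]
    rw [h]
    refine ContDiff.sum fun σ _ => ContDiff.const_smul _ (contDiff_prod fun i _ => ?_)
    refine ContDiff.sub ?_ (ContDiff.sum fun l _ => ?_)
    · split_ifs
      · exact contDiff_snd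
      · exact contDiff_const
    · exact ((contDiff_apply ℝ ℝ l).comp contDiff_fst).smul contDiff_const
  | succ r ih =>
    have h : derivCharpoly A (r + 1) = fun q => fderiv ℝ (derivCharpoly A r) q (0, 1) := by
      ext q
      rw [fderiv_derivCharpoly_apply A r q ((ih.differentiable (by simp)) q), one_mul]
    rw [h]
    exact (ih.fderiv_right (m := (⊤ : ℕ∞)) (by simp)).clm_apply contDiff_const

/-- Near a point where the `r`-th derivative of the characteristic polynomial has a simple zero, its
zero set is the graph of a smooth function of the coefficients. -/
lemma exists_graph_of_simple_zero (A : Fin k → Matrix (Fin n) (Fin n) ℂ) (r : ℕ)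
    (q : (Fin k → ℝ) × ℂ) (h0 : derivCharpoly A r q = 0) (h1 : derivCharpoly A (r + 1) q ≠ 0) :
    ∃ ψ : (Fin k → ℝ) → ℂ, ContDiffAt ℝ 1 ψ q.1 ∧ ψ q.1 = q.2 ∧
      (∀ᶠ v in 𝓝 q, derivCharpoly A r v = 0 → ψ v.1 = v.2) ∧
      ∀ᶠ α in 𝓝 q.1, derivCharpoly A r (α, ψ α) = 0 := by
  have hcd : ContDiffAt ℝ 1 (derivCharpoly A r) q :=
    ((contDiff_derivCharpoly A r).of_le (by exact_mod_cast le_top)).contDiffAt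
  have hinv : (fderiv ℝ (derivCharpoly A r) q ∘L
      ContinuousLinearMap.inr ℝ (Fin k → ℝ) ℂ).IsInvertible := by
    let e : ℂ ≃L[ℝ] ℂ :=
      (LinearEquiv.smulOfNeZero ℂ ℂ _ h1).toContinuousLinearEquiv.restrictScalars ℝ
    refine ⟨e, ?_⟩
    ext w
    · simp only [ContinuousLinearMap.comp_apply, ContinuousLinearMap.inr_apply]
      rw [fderiv_derivCharpoly_apply A r q (hcd.differentiableAt one_ne_zero)]
      exact mul_comm _ _
  refine ⟨hcd.implicitFunction one_ne_zero hinv, hcd.contDiffAt_implicitFunction one_ne_zero hinv,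
    hcd.implicitFunction_apply_self one_ne_zero hinv, ?_, ?_⟩
  · filter_upwards [hcd.eventually_apply_eq_iff_implicitFunction one_ne_zero hinv] with v hv hv0
    exact hv.1 (hv0.trans h0.symm)
  · filter_upwards [hcd.eventually_apply_implicitFunction one_ne_zero hinv] with α hα
    exact hα.trans h0

lemma mem_spectrum_iff_derivCharpoly (A : Fin k → Matrix (Fin n) (Fin n) ℂ)
    (q : (Fin k → ℝ) × ℂ) : q.2 ∈ spectrum ℂ (combo A q.1) ↔ derivCharpoly A 0 q = 0 :=
  Matrix.mem_spectrum_iff_isRoot_charpoly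

/-- In characteristic zero each derivative lowers the multiplicity by one, so a root of multiplicity
`r + 1` is a simple root of the `r`-th derivative. Multiple eigenvalues thereby come within reach of
the implicit function theorem. -/
lemma isRoot_of_rootMultiplicity_eq {p : ℂ[X]} (hp : p ≠ 0) {μ : ℂ} {r : ℕ}
    (h : p.rootMultiplicity μ = r + 1) :
    (derivative^[r] p).IsRoot μ ∧ ¬ (derivative^[r + 1] p).IsRoot μ := by
  refine ⟨isRoot_iterate_derivative_of_lt_rootMultiplicity (by omega), fun hr => ?_⟩
  have h1 : r + 1 < p.rootMultiplicity μ := by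
    rw [lt_rootMultiplicity_iff_isRoot_iterate_derivative hp]
    intro m hm
    rcases hm.eq_or_lt with rfl | hm
    · exact hr
    · exact isRoot_iterate_derivative_of_lt_rootMultiplicity (by omega)
  omega

/-- The eigenvalues over a set of coefficients form a set of no larger Hausdorff dimension. -/
theorem dimH_spectrum_le (A : Fin k → Matrix (Fin n) (Fin n) ℂ) (U : Set (Fin k → ℝ)) :
    dimH {q : (Fin k → ℝ) × ℂ | q.1 ∈ U ∧ q.2 ∈ spectrum ℂ (combo A q.1)} ≤ dimH U := by
  -- Stratify by multiplicity. Each stratum is locally contained in the graph of a Lipschitz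
  -- function over `U`, and a countable union does not raise the dimension.
  let Z : ℕ → Set ((Fin k → ℝ) × ℂ) := fun r =>
    {q | q.1 ∈ U ∧ (combo A q.1).charpoly.rootMultiplicity q.2 = r + 1}
  have hsub : {q : (Fin k → ℝ) × ℂ | q.1 ∈ U ∧ q.2 ∈ spectrum ℂ (combo A q.1)} ⊆ ⋃ r, Z r := by
    rintro q ⟨hq, hq'⟩
    have h1 := (rootMultiplicity_pos (combo A q.1).charpoly_monic.ne_zero).2
      (Matrix.mem_spectrum_iff_isRoot_charpoly.1 hq')
    exact mem_iUnion.2 ⟨(combo A q.1).charpoly.rootMultiplicity q.2 - 1, hq, by omega⟩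
  refine (dimH_mono hsub).trans ?_
  rw [dimH_iUnion]
  refine iSup_le fun r => ?_
  by_contra! hlt
  obtain ⟨q, hq, hqt⟩ := exists_mem_nhdsWithin_lt_dimH_of_lt_dimH hlt
  have hZ : ∀ v ∈ Z r, derivCharpoly A r v = 0 ∧ derivCharpoly A (r + 1) v ≠ 0 := fun v hv =>
    isRoot_of_rootMultiplicity_eq (combo A v.1).charpoly_monic.ne_zero hv.2
  obtain ⟨ψ, hψ, -, hψv, -⟩ := exists_graph_of_simple_zero A r q (hZ q hq).1 (hZ q hq).2
  obtain ⟨K, O, hO, hK⟩ := hψ.exists_lipschitzOnWith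
  have ht : Z r ∩ {v | (derivCharpoly A r v = 0 → ψ v.1 = v.2) ∧ v.1 ∈ O} ∈ 𝓝[Z r] q :=
    Filter.inter_mem self_mem_nhdsWithin
      (nhdsWithin_le_nhds (hψv.and (continuous_fst.continuousAt.preimage_mem_nhds hO)))
  refine absurd (hqt _ ht) (not_lt.2 ?_)
  have himg : Z r ∩ {v | (derivCharpoly A r v = 0 → ψ v.1 = v.2) ∧ v.1 ∈ O} ⊆
      (fun α => (α, ψ α)) '' (U ∩ O) := by
    rintro v ⟨hv, hv1, hv2⟩
    exact ⟨v.1, ⟨hv.1, hv2⟩, Prod.ext rfl (hv1 (hZ v hv).1)⟩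
  have hlip : LipschitzOnWith (max 1 K) (fun α => (α, ψ α)) (U ∩ O) :=
    (LipschitzWith.id.lipschitzOnWith).prodMk (hK.mono inter_subset_right)
  exact (dimH_mono himg).trans (hlip.dimH_image_le.trans (dimH_mono inter_subset_left))

/-- Gershgorin's circle theorem; the crude bound suffices for compactness of the eigenvalues over
the simplex. -/
lemma norm_le_of_mem_spectrum {M : Matrix (Fin n) (Fin n) ℂ} {μ : ℂ} (h : μ ∈ spectrum ℂ M) :
    ‖μ‖ ≤ ∑ i, ∑ j, ‖M i j‖ := by
  have h1 : Module.End.HasEigenvalue (Matrix.toLin' M) μ := by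
    rw [Module.End.hasEigenvalue_iff_mem_spectrum, Matrix.spectrum_toLin']
    exact h
  obtain ⟨i, hi⟩ := eigenvalue_mem_ball h1
  rw [mem_closedBall_iff_norm] at hi
  have h2 : ‖μ‖ ≤ ‖μ - M i i‖ + ‖M i i‖ := by
    simpa using norm_add_le (μ - M i i) (M i i)
  calc ‖μ‖ ≤ ∑ j, ‖M i j‖ := by
        rw [← Finset.sum_erase_add _ _ (Finset.mem_univ i)]
        linarith
    _ ≤ _ := Finset.single_le_sum (f := fun i => ∑ j, ‖M i j‖) (fun i _ => by positivity)
        (Finset.mem_univ i)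

end Charpoly

/-! ### The core as the set of matrices with simple eigenvalues -/

section Core

open Polynomial

/-- The multiplicity list is `(0, …, 0, n)` exactly for matrices with simple eigenvalues. -/
lemma multList_eq_iff (M : Matrix (Fin n) (Fin n) ℂ) :
    multList M = toLex (fun i : Fin n => if (i : ℕ) + 1 = n then n else 0) ↔
      ∀ μ, M.charpoly.rootMultiplicity μ ≤ 1 := by
  classical
  have hne : M.charpoly ≠ 0 := M.charpoly_monic.ne_zero
  have hcard : M.charpoly.roots.card = n := by
    rw [IsAlgClosed.card_roots_eq_natDegree, Matrix.charpoly_natDegree_eq_dim, Fintype.card_fin]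
  constructor
  · intro h
    rcases n.eq_zero_or_pos with hn | hn
    · intro μ
      have h1 := count_roots (a := μ) M.charpoly
      have h2 := M.charpoly.roots.count_le_card μ
      omega
    -- Position `n - 1` holds the number of simple eigenvalues; if it is `n`, these exhaust the
    -- roots of the characteristic polynomial.
    have h1 := congrFun (toLex.injective h) ⟨n - 1, by omega⟩
    simp only [show n - 1 + 1 = n by omega, if_true, show n - (n - 1) = 1 by omega] at h1
    have h2 : {μ : ℂ | M.charpoly.rootMultiplicity μ = 1} ⊆ M.charpoly.roots.toFinset := by
      intro μ hμ
      have hμ' : M.charpoly.rootMultiplicity μ = 1 := hμ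
      simp only [Finset.mem_coe, Multiset.mem_toFinset]
      rw [← Multiset.count_pos, count_roots, hμ']
      exact one_pos
    have h3 := Set.ncard_le_ncard h2 (Finset.finite_toSet _)
    rw [h1, Set.ncard_coe_finset] at h3
    have h4 : M.charpoly.roots.Nodup :=
      Multiset.toFinset_card_eq_card_iff_nodup.1
        (le_antisymm (Multiset.toFinset_card_le _) (hcard.le.trans h3))
    intro μ
    rw [← count_roots]
    exact Multiset.nodup_iff_count_le_one.1 h4 μ
  · intro h
    have h4 : M.charpoly.roots.Nodup :=
      Multiset.nodup_iff_count_le_one.2 fun μ => (count_roots M.charpoly).trans_le (h μ)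
    unfold multList
    congr 1
    ext i
    split_ifs with hi
    · have h5 : {μ : ℂ | M.charpoly.rootMultiplicity μ = n - (i : ℕ)} =
          M.charpoly.roots.toFinset := by
        ext μ
        have h6 := h μ
        simp only [mem_ofPred_eq, Finset.mem_coe, Multiset.mem_toFinset]
        rw [← Multiset.count_pos, count_roots]
        omega
      rw [h5, Set.ncard_coe_finset, Multiset.toFinset_card_of_nodup h4, hcard]
    · have h5 : {μ : ℂ | M.charpoly.rootMultiplicity μ = n - (i : ℕ)} = ∅ := by
        ext μ
        have h6 := h μ
        have h7 := i.2
        simp only [mem_ofPred_eq, mem_empty_iff_false, iff_false]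
        omega
      rw [h5, Set.ncard_empty]

/-- The core of a regular convex hull consists of its matrices with simple eigenvalues. -/
lemma mem_core_iff {A : Fin k → Matrix (Fin n) (Fin n) ℂ} (hreg : IsRegular A)
    {M : Matrix (Fin n) (Fin n) ℂ} (hM : M ∈ Co A) :
    M ∈ core A ↔ ∀ μ, M.charpoly.rootMultiplicity μ ≤ 1 := by
  rw [← multList_eq_iff]
  obtain ⟨⟨B, hB, hBe⟩, hlow⟩ := hreg
  constructor
  · rintro ⟨-, h⟩
    exact le_antisymm (hBe ▸ h B hB) (hlow ⟨M, hM, rfl⟩)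
  · intro h
    exact ⟨hM, fun B' hB' => h ▸ hlow ⟨B', hB', rfl⟩⟩

lemma combo_mem_Co (A : Fin k → Matrix (Fin n) (Fin n) ℂ) {α : Fin k → ℝ}
    (hα : α ∈ stdSimplex ℝ (Fin k)) : combo A α ∈ Co A :=
  ⟨α, hα, rfl⟩

/-- The coefficients of the matrices outside the core form a closed set. -/
theorem isClosed_nonCoreCoeff {A : Fin k → Matrix (Fin n) (Fin n) ℂ} (hreg : IsRegular A) :
    IsClosed (nonCoreCoeff A) := by
  have hΔ : IsCompact (stdSimplex ℝ (Fin k)) := isCompact_stdSimplex ℝ (Fin k)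
  obtain ⟨C, hC⟩ := hΔ.exists_bound_of_continuousOn
    (f := fun α => ∑ i, ∑ j, ‖combo A α i j‖) (by
      have := continuous_combo A
      fun_prop)
  have hS : IsCompact ((stdSimplex ℝ (Fin k) ×ˢ Metric.closedBall (0 : ℂ) C) ∩
      ({q | derivCharpoly A 0 q = 0} ∩ {q | derivCharpoly A 1 q = 0})) :=
    (hΔ.prod (isCompact_closedBall _ _)).inter_right
      ((isClosed_eq (contDiff_derivCharpoly A 0).continuous continuous_const).inter
        (isClosed_eq (contDiff_derivCharpoly A 1).continuous continuous_const))
  -- A multiple eigenvalue is a common zero of the characteristic polynomial and its derivative. The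
  -- bound `C` makes the set of such pairs compact, hence its projection closed.
  have heq : nonCoreCoeff A = Prod.fst '' ((stdSimplex ℝ (Fin k) ×ˢ Metric.closedBall (0 : ℂ) C) ∩
      ({q | derivCharpoly A 0 q = 0} ∩ {q | derivCharpoly A 1 q = 0})) := by
    ext α
    constructor
    · rintro ⟨hα, hM, hcore⟩
      rw [mem_core_iff hreg hM] at hcore
      push Not at hcore
      obtain ⟨μ, hμ⟩ := hcore
      rw [one_lt_rootMultiplicity_iff_isRoot (combo A α).charpoly_monic.ne_zero] at hμ
      refine ⟨(α, μ), ⟨⟨hα, ?_⟩, hμ⟩, rfl⟩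
      rw [mem_closedBall_zero_iff]
      refine (norm_le_of_mem_spectrum (Matrix.mem_spectrum_iff_isRoot_charpoly.2 hμ.1)).trans ?_
      exact (le_abs_self _).trans (hC α hα)
    · rintro ⟨⟨α, μ⟩, ⟨⟨hα, -⟩, hμ⟩, rfl⟩
      refine ⟨hα, combo_mem_Co A hα, fun hcore => ?_⟩
      rw [mem_core_iff hreg (combo_mem_Co A hα)] at hcore
      exact absurd ((one_lt_rootMultiplicity_iff_isRoot (combo A α).charpoly_monic.ne_zero).2 hμ)
        (not_lt.2 (hcore μ))
  rw [heq]
  exact (hS.image continuous_fst).isClosed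

end Core

/-! ### The dimension of the manifold is at least that of the simplex -/

section Dimension

open Module

lemma combo_add (A : Fin k → Matrix (Fin n) (Fin n) ℂ) (x y : Fin k → ℝ) :
    combo A (x + y) = combo A x + combo A y := by
  simp [combo, add_smul, Finset.sum_add_distrib]

lemma combo_smul (A : Fin k → Matrix (Fin n) (Fin n) ℂ) (c : ℝ) (x : Fin k → ℝ) :
    combo A (c • x) = c • combo A x := by
  simp [combo, Finset.smul_sum, mul_smul]

lemma combo_sub (A : Fin k → Matrix (Fin n) (Fin n) ℂ) (x y : Fin k → ℝ) :
    combo A (x - y) = combo A x - combo A y := by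
  simp [combo, sub_smul, Finset.sum_sub_distrib]

/-- Every neighbourhood of a point of the simplex contains an affinely embedded ball of the
direction space of the simplex. -/
lemma exists_embedding_stdSimplex (hk : 0 < k) {β : Fin k → ℝ} (hβ : β ∈ stdSimplex ℝ (Fin k))
    {N : Set (Fin k → ℝ)} (hN : N ∈ 𝓝 β) :
    ∃ G : Submodule ℝ (EuclideanSpace ℝ (Fin k)), finrank ℝ G + 1 = k ∧
      ∃ s ∈ 𝓝 (0 : G), ∃ θ : G → Fin k → ℝ, Continuous θ ∧ Function.Injective θ ∧
        ∀ v ∈ s, θ v ∈ N ∩ stdSimplex ℝ (Fin k) := by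
  have hk0 : (0 : ℝ) < k := by exact_mod_cast hk
  set e : EuclideanSpace ℝ (Fin k) := WithLp.toLp 2 fun _ => (1 : ℝ) with he
  have he0 : e ≠ 0 := by
    intro h
    have := congrArg (fun x : EuclideanSpace ℝ (Fin k) => x ⟨0, hk⟩) h
    simp [e] at this
  have hG : ∀ v : (ℝ ∙ e)ᗮ, ∑ i, (v : EuclideanSpace ℝ (Fin k)) i = 0 := by
    intro v
    have := Submodule.mem_orthogonal_singleton_iff_inner_right.1 v.2
    simpa [e, PiLp.inner_apply] using this
  obtain ⟨δ, hδ, hδN⟩ := Metric.mem_nhds_iff.1 hN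
  set c : ℝ := min 1 (δ / 4) with hc
  have hc0 : 0 < c := lt_min one_pos (by positivity)
  have hc1 : c ≤ 1 := min_le_left _ _
  have hcδ : c ≤ δ / 4 := min_le_right _ _
  -- As `β` may lie on the boundary, it is first moved towards the barycentre: `θ v` is `(1 - c) β +
  -- c (1/k + v)`, with nonnegative coordinates while `|v i| < 1/k`. Since `c ≤ δ / 4` and the
  -- displacement is at most `3 c`, it stays within `δ` of `β`.
  let θ : (ℝ ∙ e)ᗮ → Fin k → ℝ := fun v i =>
    β i + c * ((k : ℝ)⁻¹ - β i + (v : EuclideanSpace ℝ (Fin k)) i)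
  refine ⟨(ℝ ∙ e)ᗮ, ?_, {v | ∀ i, |(v : EuclideanSpace ℝ (Fin k)) i| < (k : ℝ)⁻¹}, ?_, θ, ?_, ?_, ?_⟩
  · have := Submodule.finrank_add_finrank_orthogonal (ℝ ∙ e)
    rw [finrank_span_singleton he0, finrank_euclideanSpace_fin] at this
    omega
  · refine Filter.eventually_all.2 fun i => ?_
    have h1 : Continuous fun v : (ℝ ∙ e)ᗮ => |(v : EuclideanSpace ℝ (Fin k)) i| := by fun_prop
    exact (h1.tendsto 0).eventually_lt_const (by simpa using hk0)
  · fun_prop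
  · intro v w hvw
    ext i
    have := congrFun hvw i
    simp only [θ, add_right_inj, mul_eq_mul_left_iff, hc0.ne', or_false] at this
    exact this
  · intro v hv
    have hv' : ∀ i, |(v : EuclideanSpace ℝ (Fin k)) i| < (k : ℝ)⁻¹ := hv
    have hkinv : (k : ℝ)⁻¹ ≤ 1 := inv_le_one_of_one_le₀ (by exact_mod_cast hk)
    constructor
    · refine hδN ?_
      rw [Metric.mem_ball, dist_pi_lt_iff hδ]
      intro i
      rw [Real.dist_eq]
      have h1 := abs_lt.1 (hv' i)
      have h2 : β i ≤ 1 := (mem_Icc_of_mem_stdSimplex hβ i).2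
      have h3 := hβ.1 i
      have h4 : |((k : ℝ)⁻¹ - β i + (v : EuclideanSpace ℝ (Fin k)) i)| ≤ 3 := by
        rw [abs_le]
        constructor <;> linarith
      simp only [θ, add_sub_cancel_left, abs_mul, abs_of_pos hc0]
      nlinarith [abs_nonneg ((k : ℝ)⁻¹ - β i + (v : EuclideanSpace ℝ (Fin k)) i)]
    · constructor
      · intro i
        have h1 := abs_lt.1 (hv' i)
        have h3 := hβ.1 i
        have h4 : θ v i = (1 - c) * β i + c * ((k : ℝ)⁻¹ + (v : EuclideanSpace ℝ (Fin k)) i) := by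
          simp only [θ]; ring
        rw [h4]
        have : 0 ≤ (1 - c) * β i := mul_nonneg (by linarith) h3
        have : 0 ≤ c * ((k : ℝ)⁻¹ + (v : EuclideanSpace ℝ (Fin k)) i) :=
          mul_nonneg hc0.le (by linarith)
        linarith
      · simp only [θ, Finset.sum_add_distrib, ← Finset.mul_sum, Finset.sum_sub_distrib, hG v, hβ.2]
        simp [hk0.ne']

/-- A manifold structure near a point of the eigen-surface over the core has at least the dimension
of the simplex. -/
theorem le_finrank_of_mem_core {A : Fin k → Matrix (Fin n) (Fin n) ℂ} (hreg : IsRegular A)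
    {E : Type*} [NormedAddCommGroup E] [InnerProductSpace ℝ E] [FiniteDimensional ℝ E]
    {H : Type*} [TopologicalSpace H] (I : ModelWithCorners ℝ E H)
    {O : Set ((Fin k → ℝ) × ℂ)} (hO : IsOpen O) [ChartedSpace H ↥(O ∩ ES A (Co A))]
    {q : (Fin k → ℝ) × ℂ} (hqO : q ∈ O ∩ ES A (Co A)) (hq : combo A q.1 ∈ core A) :
    k - 1 ≤ finrank ℝ E := by
  rcases k.eq_zero_or_pos with rfl | hk
  · simp
  have hmem := hqO.2
  have hmult : (combo A q.1).charpoly.rootMultiplicity q.2 = 0 + 1 := by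
    have h1 := (mem_core_iff hreg hmem.2.1).1 hq q.2
    have h2 := (Polynomial.rootMultiplicity_pos (combo A q.1).charpoly_monic.ne_zero).2
      (Matrix.mem_spectrum_iff_isRoot_charpoly.1 hmem.2.2)
    omega
  obtain ⟨h0, h1⟩ := isRoot_of_rootMultiplicity_eq (combo A q.1).charpoly_monic.ne_zero hmult
  obtain ⟨ψ, hψ, hψq, -, hψ0⟩ := exists_graph_of_simple_zero A 0 q h0 h1
  have hpair : ContinuousAt (fun α => (α, ψ α)) q.1 := continuousAt_id.prodMk hψ.continuousAt
  have hN : ∀ᶠ α in 𝓝 q.1, ContinuousAt ψ α ∧ derivCharpoly A 0 (α, ψ α) = 0 ∧ (α, ψ α) ∈ O := by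
    refine Filter.Eventually.and ?_ (hψ0.and ?_)
    · exact (hψ.eventually (by simp)).mono fun α h => h.continuousAt
    · exact hpair.preimage_mem_nhds (hO.mem_nhds (by simpa [hψq] using hqO.1))
  obtain ⟨G, hG, s, hs, θ, hθ, hθi, hθs⟩ := exists_embedding_stdSimplex hk hmem.1 hN
  classical
  -- The default value `q` is never taken on `s`, where the graph lies in the surface.
  let h : G → ↥(O ∩ ES A (Co A)) := fun v =>
    if hv : (θ v, ψ (θ v)) ∈ O ∩ ES A (Co A) then ⟨_, hv⟩ else ⟨q, hqO⟩
  have hh : ∀ v ∈ s, (h v : (Fin k → ℝ) × ℂ) = (θ v, ψ (θ v)) := by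
    intro v hv
    obtain ⟨⟨-, hv0, hvO⟩, hvΔ⟩ := hθs v hv
    have : (θ v, ψ (θ v)) ∈ O ∩ ES A (Co A) :=
      ⟨hvO, hvΔ, combo_mem_Co A hvΔ, (mem_spectrum_iff_derivCharpoly A _).2 hv0⟩
    exact congrArg Subtype.val (dif_pos this)
  have hcont : ContinuousOn h s := by
    rw [IsInducing.subtypeVal.continuousOn_iff]
    refine ContinuousOn.congr (f := fun v => (θ v, ψ (θ v))) (fun v hv => ?_) hh
    refine ContinuousAt.continuousWithinAt (hθ.continuousAt.prodMk ?_)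
    exact ContinuousAt.comp (hθs v hv).1.1 hθ.continuousAt
  have hinj : InjOn h s := by
    intro v hv w hw hvw
    have h2 := congrArg Subtype.val hvw
    rw [hh v hv, hh w hw] at h2
    exact hθi (congrArg Prod.fst h2)
  have := finrank_le_of_embedding_ball I hs hcont hinj
  omega

end Dimension

/-! ### A continuous choice of coefficients -/

section Selection

/-- By the parallelogram identity the midpoint of two distinct minimisers would be strictly closer
to `α`. -/
lemma sum_sq_eq_of_minimal {S : Set (Fin k → ℝ)} (hS : Convex ℝ S) {α y z : Fin k → ℝ}
    (hy : y ∈ S) (hz : z ∈ S) (hmin : ∀ w ∈ S, ∑ i, (z i - α i) ^ 2 ≤ ∑ i, (w i - α i) ^ 2)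
    (hle : ∑ i, (y i - α i) ^ 2 ≤ ∑ i, (z i - α i) ^ 2) : y = z := by
  have h1 := hmin _ (hS hy hz (by norm_num : (0 : ℝ) ≤ 1 / 2) (by norm_num : (0 : ℝ) ≤ 1 / 2)
    (by norm_num))
  have h2 : ∑ i, (((1 / 2 : ℝ) • y + (1 / 2 : ℝ) • z) i - α i) ^ 2 =
      (∑ i, (y i - α i) ^ 2) / 2 + (∑ i, (z i - α i) ^ 2) / 2 - (∑ i, (y i - z i) ^ 2) / 4 := by
    simp only [Finset.sum_div, ← Finset.sum_add_distrib, ← Finset.sum_sub_distrib]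
    refine Finset.sum_congr rfl fun i _ => ?_
    simp only [Pi.add_apply, Pi.smul_apply, smul_eq_mul]
    ring
  have h3 : ∑ i, (y i - z i) ^ 2 ≤ 0 := by linarith
  have h4 := (Finset.sum_eq_zero_iff_of_nonneg fun i _ => sq_nonneg (y i - z i)).1
    (le_antisymm h3 (Finset.sum_nonneg fun i _ => sq_nonneg _))
  ext i
  have := h4 i (Finset.mem_univ i)
  exact sub_eq_zero.1 (pow_eq_zero_iff two_ne_zero |>.1 this)

/-- The coefficients nearest to `α` depend continuously on the matrix: there is a continuous
selection of coefficients for the matrices of the convex hull that chooses `α` for `combo A α`. -/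
theorem exists_continuous_selection (A : Fin k → Matrix (Fin n) (Fin n) ℂ) {α : Fin k → ℝ}
    (hα : α ∈ stdSimplex ℝ (Fin k)) :
    ∃ σ : (Fin k → ℝ) → Fin k → ℝ, ContinuousOn σ (stdSimplex ℝ (Fin k)) ∧
      (∀ x ∈ stdSimplex ℝ (Fin k), σ x ∈ stdSimplex ℝ (Fin k) ∧ combo A (σ x) = combo A x) ∧
      ∀ x ∈ stdSimplex ℝ (Fin k), combo A x = combo A α → σ x = α := by
  set Δ := stdSimplex ℝ (Fin k) with hΔ
  have hΔc : IsCompact Δ := isCompact_stdSimplex ℝ (Fin k)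
  let d : (Fin k → ℝ) → ℝ := fun y => ∑ i, (y i - α i) ^ 2
  have hd : Continuous d := by fun_prop
  let fib : (Fin k → ℝ) → Set (Fin k → ℝ) := fun x => Δ ∩ {y | combo A y = combo A x}
  have hfc : ∀ x, Convex ℝ (fib x) := by
    refine fun x => (convex_stdSimplex ℝ _).inter fun y hy z hz a b _ _ hab => ?_
    have hy' : combo A y = combo A x := hy
    have hz' : combo A z = combo A x := hz
    show combo A _ = combo A x
    rw [combo_add, combo_smul, combo_smul, hy', hz', ← add_smul, hab, one_smul]
  have hex : ∀ x, ∃ y, x ∈ Δ → y ∈ fib x ∧ ∀ w ∈ fib x, d y ≤ d w := by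
    intro x
    by_cases hx : x ∈ Δ
    · have hcomp : IsCompact (fib x) :=
        hΔc.inter_right (isClosed_eq (continuous_combo A) continuous_const)
      obtain ⟨y, hy, hy'⟩ := hcomp.exists_isMinOn ⟨x, hx, rfl⟩ hd.continuousOn
      exact ⟨y, fun _ => ⟨hy, fun w hw => hy' hw⟩⟩
    · exact ⟨x, fun h => absurd h hx⟩
  choose σ hσ using hex
  have hσΔ : ∀ x ∈ Δ, σ x ∈ Δ ∧ combo A (σ x) = combo A x := fun x hx => (hσ x hx).1
  refine ⟨σ, fun x hx => ?_, hσΔ, fun x hx hxα => ?_⟩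
  -- By compactness it is enough to identify cluster points: such a `y` lies in the fibre of `x`,
  -- and uniqueness of the minimiser gives `y = σ x` once `d y ≤ d (σ x)` is known.
  · refine hΔc.tendsto_nhds_of_unique_mapClusterPt
      (Filter.eventually_of_mem self_mem_nhdsWithin fun z hz => (hσΔ z hz).1) fun y hy hyc => ?_
    obtain ⟨U, hU, hUy⟩ := mapClusterPt_iff_ultrafilter.1 hyc
    have hUΔ : ∀ᶠ z in (U : Filter (Fin k → ℝ)), z ∈ Δ := hU self_mem_nhdsWithin
    have hUx : Filter.Tendsto id (U : Filter (Fin k → ℝ)) (𝓝 x) := hU.trans nhdsWithin_le_nhds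
    have hyx : combo A y = combo A x := by
      refine tendsto_nhds_unique (((continuous_combo A).tendsto y).comp hUy) ?_
      refine Filter.Tendsto.congr' ?_ (((continuous_combo A).tendsto x).comp hUx)
      filter_upwards [hUΔ] with z hz
      exact (hσΔ z hz).2.symm
    refine sum_sq_eq_of_minimal (hfc x) ⟨hy, hyx⟩ (hσ x hx).1 (hσ x hx).2 ?_
    -- Fibres do not jump: for `z` near `x` the competitor `(1 - s) σ x + s x + (z - x)` lies in the
    -- fibre of `z`. Where `x i = 0` it is nonnegative because `z i` is; where `x i > 0` the share
    -- `s x` leaves room, whence `s > 0`. Then `z` tends to `x`, and afterwards `s` to 0.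
    have hstep : ∀ s ∈ Ioc (0 : ℝ) 1, d y ≤ d ((1 - s) • σ x + s • x) := by
      intro s hs
      have hev : ∀ᶠ z in (U : Filter (Fin k → ℝ)), d (σ z) ≤ d ((1 - s) • σ x + s • x + (z - x)) := by
        have hpos : ∀ᶠ z in (U : Filter (Fin k → ℝ)), ∀ i, 0 < x i →
            0 ≤ ((1 - s) • σ x + s • x + (z - x)) i := by
          refine Filter.eventually_all.2 fun i => Filter.eventually_imp_distrib_left.2 fun hi => ?_
          have hc : Continuous fun z : Fin k → ℝ => ((1 - s) • σ x + s • x + (z - x)) i := by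
            fun_prop
          have h1 := (hc.tendsto x).comp hUx
          refine (h1.eventually_const_lt (u := 0) ?_).mono fun z hz => hz.le
          rw [sub_self, add_zero]
          simp only [Pi.add_apply, Pi.smul_apply, smul_eq_mul]
          have h2 := (hσΔ x hx).1.1 i
          have : 0 ≤ (1 - s) * σ x i := mul_nonneg (by linarith [hs.2]) h2
          have : 0 < s * x i := mul_pos hs.1 hi
          linarith
        filter_upwards [hUΔ, hpos] with z hz hzp
        refine (hσ z hz).2 _ ⟨⟨fun i => ?_, ?_⟩, ?_⟩
        · rcases (hx.1 i).eq_or_lt with hi | hi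
          · simp only [Pi.add_apply, Pi.smul_apply, smul_eq_mul, Pi.sub_apply, ← hi]
            have h2 := (hσΔ x hx).1.1 i
            have h3 := hz.1 i
            have : 0 ≤ (1 - s) * σ x i := mul_nonneg (by linarith [hs.2]) h2
            linarith
          · exact hzp i hi
        · simp only [Pi.add_apply, Pi.smul_apply, smul_eq_mul, Pi.sub_apply,
            Finset.sum_add_distrib, Finset.sum_sub_distrib, ← Finset.mul_sum, hx.2, hz.2,
            (hσΔ x hx).1.2]
          ring
        · show combo A _ = combo A z
          rw [combo_add, combo_add, combo_smul, combo_smul, combo_sub, (hσΔ x hx).2, ← add_smul]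
          simp
      have hc : Continuous fun z : Fin k → ℝ => d ((1 - s) • σ x + s • x + (z - x)) := by
        fun_prop
      have h1 := (hc.tendsto x).comp hUx
      simp only [sub_self, add_zero] at h1
      exact le_of_tendsto_of_tendsto ((hd.tendsto y).comp hUy) h1 hev
    have hc : Continuous fun s : ℝ => d ((1 - s) • σ x + s • x) := by fun_prop
    have h1 : Filter.Tendsto (fun s : ℝ => d ((1 - s) • σ x + s • x)) (𝓝[>] 0)
        (𝓝 (d (σ x))) := by
      have := (hc.tendsto 0).mono_left (nhdsWithin_le_nhds (s := Ioi 0))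
      simpa using this
    refine ge_of_tendsto h1 ?_
    filter_upwards [Ioc_mem_nhdsGT (zero_lt_one (α := ℝ))] with s hs
    exact hstep s hs
  · refine (sum_sq_eq_of_minimal (hfc x) ⟨hα, hxα.symm⟩ (hσ x hx).1 (hσ x hx).2 ?_)
      |>.symm
    simp only [sub_self, ne_eq, OfNat.ofNat_ne_zero, not_false_eq_true, zero_pow,
      Finset.sum_const_zero]
    exact Finset.sum_nonneg fun i _ => sq_nonneg _

end Selection

/-! ### Moving paths close to p, and conclusion -/

section Localization

lemma continuous_frobeniusDist (A : Fin k → Matrix (Fin n) (Fin n) ℂ)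
    (M : Matrix (Fin n) (Fin n) ℂ) :
    Continuous fun x => √(∑ i, ∑ j, ‖combo A x i j - M i j‖ ^ 2) := by
  have := continuous_combo A
  fun_prop

lemma isOpen_combo_preimage_matrixBall (A : Fin k → Matrix (Fin n) (Fin n) ℂ)
    (M : Matrix (Fin n) (Fin n) ℂ) (ε : ℝ) : IsOpen (combo A ⁻¹' matrixBall M ε) :=
  isOpen_lt (continuous_frobeniusDist A M) continuous_const

lemma isOpen_pointBall (p : (Fin k → ℝ) × ℂ) (ε : ℝ) : IsOpen (pointBall p ε) :=
  isOpen_lt (by fun_prop) continuous_const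

lemma mem_pointBall_self (p : (Fin k → ℝ) × ℂ) {ε : ℝ} (hε : 0 < ε) : p ∈ pointBall p ε := by
  simpa [pointBall] using hε

/-- A compact set of coefficients whose matrices differ from `M` avoids a ball about `M`. -/
lemma exists_forall_notMem_matrixBall (A : Fin k → Matrix (Fin n) (Fin n) ℂ)
    (M : Matrix (Fin n) (Fin n) ℂ) {K : Set (Fin k → ℝ)} (hK : IsCompact K)
    (h : ∀ x ∈ K, combo A x ≠ M) : ∃ ε > 0, ∀ x ∈ K, combo A x ∉ matrixBall M ε := by
  rcases K.eq_empty_or_nonempty with rfl | hne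
  · exact ⟨1, one_pos, fun x hx => absurd hx (notMem_empty x)⟩
  obtain ⟨x, hx, hmin⟩ := hK.exists_isMinOn hne (continuous_frobeniusDist A M).continuousOn
  refine ⟨_, ?_, fun y hy hyM => lt_irrefl _ (lt_of_lt_of_le hyM (isMinOn_iff.1 hmin y hy))⟩
  have h0 : 0 ≤ ∑ i, ∑ j, ‖combo A x i j - M i j‖ ^ 2 := by positivity
  refine Real.sqrt_pos.2 (h0.lt_of_ne fun h1 => h x hx ?_)
  ext i j
  have h2 := (Finset.sum_eq_zero_iff_of_nonneg fun i _ => by positivity).1 h1.symm i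
    (Finset.mem_univ i)
  have h3 := (Finset.sum_eq_zero_iff_of_nonneg fun j _ => by positivity).1 h2 j (Finset.mem_univ j)
  exact sub_eq_zero.1 (norm_eq_zero.1 (pow_eq_zero_iff two_ne_zero |>.1 h3))

/-- The spectrum is finite, so all but finitely many radii work. The circle serves as a barrier for
paths of eigenvalues. -/
lemma exists_radius_forall_notMem_spectrum (M : Matrix (Fin n) (Fin n) ℂ) (lam : ℂ) {r : ℝ}
    (hr : 0 < r) : ∃ δ, 0 < δ ∧ δ < r ∧ ∀ μ ∈ spectrum ℂ M, dist μ lam ≠ δ := by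
  obtain ⟨δ, hδ, hδ'⟩ := (Ioo_infinite hr).exists_notMem_finite
    (M.charpoly.roots.toFinset.image fun μ => dist μ lam).finite_toSet
  refine ⟨δ, hδ.1, hδ.2, fun μ hμ h => hδ' ?_⟩
  simp only [Finset.coe_image, mem_image, Finset.mem_coe, Multiset.mem_toFinset]
  exact ⟨μ, (Polynomial.mem_roots M.charpoly_monic.ne_zero).2
    (Matrix.mem_spectrum_iff_isRoot_charpoly.1 hμ), h⟩

/-- Paths of eigenvalues to `p` over a small ball of matrices can be moved, without changing the
matrices, into a prescribed neighbourhood of `p`. -/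
theorem exists_localization (A : Fin k → Matrix (Fin n) (Fin n) ℂ) {p : (Fin k → ℝ) × ℂ}
    (hp : p ∈ ES A (Co A)) {r : ℝ} (hr : 0 < r) :
    ∃ σ : (Fin k → ℝ) → Fin k → ℝ, (∀ x ∈ stdSimplex ℝ (Fin k),
      σ x ∈ stdSimplex ℝ (Fin k) ∧ combo A (σ x) = combo A x) ∧
      ∃ ε₀ > 0, ∀ ε < ε₀, ∀ (β : Fin k → ℝ) (μ : ℂ),
        JoinedIn (ES A (matrixBall (combo A p.1) ε ∩ Co A)) (β, μ) p →
        JoinedIn (Metric.ball p r ∩ ES A (matrixBall (combo A p.1) ε ∩ Co A)) (σ β, μ) p := by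
  obtain ⟨σ, hσc, hσ, hσp⟩ := exists_continuous_selection A hp.1
  have hΔ : IsCompact (stdSimplex ℝ (Fin k)) := isCompact_stdSimplex ℝ (Fin k)
  -- No coefficients selected at distance `r` or more from `p.1` give the matrix of `p`, since for
  -- that matrix `σ` selects `p.1`. By compactness, close matrices have selected coefficients near
  -- `p.1`.
  obtain ⟨ε₁, hε₁, hε₁'⟩ := exists_forall_notMem_matrixBall A (combo A p.1)
    (K := stdSimplex ℝ (Fin k) ∩ σ ⁻¹' (Metric.ball p.1 r)ᶜ)
    (hΔ.of_isClosed_subset (hσc.preimage_isClosed_of_isClosed hΔ.isClosed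
      Metric.isOpen_ball.isClosed_compl) inter_subset_left)
    (fun x hx h => hx.2 (by rw [hσp x hx.1 h]; exact Metric.mem_ball_self hr))
  obtain ⟨δ, hδ, hδr, hδs⟩ := exists_radius_forall_notMem_spectrum (combo A p.1) p.2 hr
  -- Likewise, matrices close to that of `p` have no eigenvalue on the circle of radius `δ`.
  obtain ⟨ε₂, hε₂, hε₂'⟩ := exists_forall_notMem_matrixBall A (combo A p.1)
    (K := Prod.fst '' ((stdSimplex ℝ (Fin k) ×ˢ Metric.sphere p.2 δ) ∩
      {q | derivCharpoly A 0 q = 0}))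
    (((hΔ.prod (isCompact_sphere _ _)).inter_right
      (isClosed_eq (contDiff_derivCharpoly A 0).continuous continuous_const)).image continuous_fst)
    (by
      rintro - ⟨q, ⟨⟨-, hqδ⟩, hq⟩, rfl⟩ h
      have h1 := (mem_spectrum_iff_derivCharpoly A q).2 hq
      rw [h] at h1
      exact hδs _ h1 hqδ)
  refine ⟨σ, hσ, min ε₁ ε₂, lt_min hε₁ hε₂, fun ε hε β μ hj => ?_⟩
  have hball : ∀ {ε'}, min ε₁ ε₂ ≤ ε' → matrixBall (combo A p.1) ε ⊆ matrixBall (combo A p.1) ε' :=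
    fun h B hB => lt_trans hB (hε.trans_le h)
  obtain ⟨γ, hγ⟩ := hj
  have hcircle : ∀ t, dist (γ t).2 p.2 ≠ δ := by
    intro t ht
    refine hε₂' (γ t).1 ⟨γ t, ⟨⟨(hγ t).1, ht⟩, ?_⟩, rfl⟩ (hball (min_le_right _ _) (hγ t).2.1.1)
    exact (mem_spectrum_iff_derivCharpoly A _).1 (hγ t).2.2
  -- The path ends at `p`, inside the circle, and cannot cross it.
  have hsmall : ∀ t, dist (γ t).2 p.2 < δ := by
    intro t
    by_contra! hge
    have hc : Continuous fun t => dist (γ t).2 p.2 := by fun_prop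
    obtain ⟨s, hs⟩ := mem_range_of_exists_le_of_exists_ge hc
      ⟨1, by simpa using hδ.le⟩ ⟨t, hge⟩
    exact hcircle s hs
  have hσcont : Continuous fun t => σ (γ t).1 :=
    hσc.comp_continuous (by fun_prop) fun t => (hγ t).1
  have hpp : σ p.1 = p.1 := hσp p.1 hp.1 rfl
  -- Only the coefficients are replaced; the matrices and eigenvalues along the path are unchanged.
  refine ⟨⟨⟨fun t => (σ (γ t).1, (γ t).2), hσcont.prodMk (by fun_prop)⟩, by simp, by simp [hpp]⟩, fun t => ?_⟩
  obtain ⟨h1, h2⟩ := hσ _ (hγ t).1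
  refine ⟨?_, h1, ?_, ?_⟩
  · rw [Metric.mem_ball, Prod.dist_eq]
    refine max_lt ?_ ((hsmall t).trans hδr)
    by_contra hge
    exact hε₁' (γ t).1 ⟨(hγ t).1, hge⟩ (hball (min_le_left _ _) (hγ t).2.1.1)
  · exact h2 ▸ (hγ t).2.1
  · exact h2 ▸ (hγ t).2.2

/-- The coefficients of one matrix form a convex set, so a segment with `μ` fixed stays in the
surface. This undoes the passage from `β` to `σ β`. -/
lemma joinedIn_fibre {A : Fin k → Matrix (Fin n) (Fin n) ℂ} {S : Set (Matrix (Fin n) (Fin n) ℂ)}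
    {β β' : Fin k → ℝ} {μ : ℂ} (h : (β, μ) ∈ ES A S) (hβ' : β' ∈ stdSimplex ℝ (Fin k))
    (heq : combo A β' = combo A β) : JoinedIn (ES A S) (β, μ) (β', μ) := by
  refine JoinedIn.ofLine (f := fun t => (AffineMap.lineMap β β' t, μ)) ?_ (by simp) (by simp) ?_
  · have : Continuous fun t : ℝ => (AffineMap.lineMap β β' t : Fin k → ℝ) :=
      AffineMap.lineMap_continuous
    fun_prop
  · rintro - ⟨t, ht, rfl⟩
    have h1 : combo A (AffineMap.lineMap β β' t) = combo A β := by
      rw [AffineMap.lineMap_apply_module, combo_add, combo_smul, combo_smul, heq, ← add_smul,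
        sub_add_cancel, one_smul]
    refine ⟨(convex_stdSimplex ℝ (Fin k)).lineMap_mem h.1 hβ' ht, ?_, ?_⟩
    · exact h1 ▸ h.2.1
    · exact h1 ▸ h.2.2

/-- If a neighbourhood of `p` in the eigen-surface is modelled on a finite-dimensional Euclidean
space, possibly with boundary, then the matrix is locally non-transitive about `p`. -/
theorem locallyNonTransitive_of_chartedSpace {A : Fin k → Matrix (Fin n) (Fin n) ℂ}
    (hreg : IsRegular A) (hcodim : CodimAtLeastTwo A) {p : (Fin k → ℝ) × ℂ}
    (hp : p ∈ ES A (Co A)) {ε : ℝ} (hε : 0 < ε)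
    {E : Type*} [NormedAddCommGroup E] [InnerProductSpace ℝ E] [FiniteDimensional ℝ E]
    {H : Type*} [TopologicalSpace H] [LocallyPathConnectedSpace H] (I : ModelWithCorners ℝ E H)
    [ChartedSpace H ↥(pointBall p ε ∩ ES A (Co A))] : LocallyNonTransitive A p := by
  have : LocallyPathConnectedSpace ↥(pointBall p ε ∩ ES A (Co A)) :=
    ChartedSpace.locallyPathConnectedSpace H _
  obtain ⟨r, hr, hrε⟩ := Metric.isOpen_iff.1 (isOpen_pointBall p ε) p (mem_pointBall_self p hε)
  obtain ⟨σ, hσ, ε₀, hε₀, hloc⟩ := exists_localization A hp hr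
  refine ⟨ε₀, hε₀, fun ε' _ hε'₀ β μ₁ μ₂ h₁ h₂ hp₁ hp₂ => ?_⟩
  set X := pointBall p ε ∩ ES A (Co A) with hX
  have hj₁ := hloc ε' hε'₀ β μ₁ hp₁
  have hj₂ := hloc ε' hε'₀ β μ₂ hp₂
  obtain ⟨hσβ, hσβ'⟩ := hσ β h₁.1
  set T := Metric.ball p r ∩ ES A (matrixBall (combo A p.1) ε' ∩ Co A) with hT
  have hTX : T ⊆ X := fun q hq => ⟨hrε hq.1, hq.2.1, hq.2.2.1.2, hq.2.2.2⟩
  let W : Set X := Subtype.val ⁻¹' T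
  have hWo : IsOpen W := by
    have h1 : W = Subtype.val ⁻¹'
        (Metric.ball p r ∩ Prod.fst ⁻¹' (combo A ⁻¹' matrixBall (combo A p.1) ε')) := by
      ext q
      exact ⟨fun h => ⟨h.1, h.2.2.1.1⟩, fun h => ⟨h.1, q.2.2.1, ⟨h.2, q.2.2.2.1⟩, q.2.2.2.2⟩⟩
    rw [h1]
    exact (Metric.isOpen_ball.inter
      ((isOpen_combo_preimage_matrixBall A _ _).preimage continuous_fst)).preimage
      continuous_subtype_val
  have himg : (Subtype.val '' W : Set ((Fin k → ℝ) × ℂ)) = T := by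
    rw [Subtype.image_preimage_coe, inter_eq_right.2 hTX]
  let P : X := ⟨p, hTX hj₁.target_mem⟩
  let Q₁ : X := ⟨(σ β, μ₁), hTX hj₁.source_mem⟩
  let Q₂ : X := ⟨(σ β, μ₂), hTX hj₂.source_mem⟩
  have hlift : ∀ Q : X, JoinedIn T Q p → JoinedIn W P Q := by
    intro Q hQ
    refine (IsInducing.subtypeVal.joinedIn_image (x := P) (y := Q) hQ.target_mem hQ.source_mem).1 ?_
    rw [himg]
    exact hQ.symm
  let Z : Set ((Fin k → ℝ) × ℂ) := {q | q.1 ∈ nonCoreCoeff A ∧ q.2 ∈ spectrum ℂ (combo A q.1)}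
  have hcore : ∀ q : X, q ∉ (Subtype.val ⁻¹' Z : Set X) → combo A q.1.1 ∈ core A := by
    intro q hq
    by_contra hn
    exact hq ⟨⟨q.2.2.1, q.2.2.2.1, hn⟩, q.2.2.2.2⟩
  have hZcl : IsClosed (Subtype.val ⁻¹' Z : Set X) := by
    have h1 : (Subtype.val ⁻¹' Z : Set X) = (fun q : X => q.1.1) ⁻¹' nonCoreCoeff A := by
      ext q
      exact ⟨fun h => h.1, fun h => ⟨h, q.2.2.2.2⟩⟩
    rw [h1]
    exact (isClosed_nonCoreCoeff hreg).preimage (by fun_prop)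
  have hcβ : combo A (σ β) ∈ core A := hσβ' ▸ h₁.2.1.2
  have hQZ : ∀ Q : X, Q.1.1 = σ β → Q ∉ (Subtype.val ⁻¹' Z : Set X) := by
    rintro Q hQ ⟨h, -⟩
    rw [hQ] at h
    exact h.2.2 hcβ
  -- The inequality is enough: a larger manifold dimension only increases the codimension of `Z`.
  have hdim : Module.finrank ℝ E ≥ k - 1 :=
    le_finrank_of_mem_core hreg I (isOpen_pointBall p ε) Q₁.2 hcβ
  have hZdim : dimH Z + 2 ≤ Module.finrank ℝ E := by
    refine (add_le_add_left (dimH_spectrum_le A (nonCoreCoeff A)) 2).trans (hcodim.trans ?_)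
    exact_mod_cast hdim
  -- `C` contains both eigenvalues and is open because the manifold is locally path connected; this
  -- also turns connectedness of `C` minus `Z` into a path over the core.
  set C := pathComponentIn W P
  have hPW : P ∈ W := hj₁.target_mem
  have hCo : IsOpen C := hWo.pathComponentIn P
  have hpre := isPreconnected_diff_preimage I continuous_subtype_val Subtype.val_injective hZdim hZcl
    hCo (isPathConnected_pathComponentIn hPW).isConnected.isPreconnected
  have hQ₁ : Q₁ ∈ C \ (Subtype.val ⁻¹' Z : Set X) := ⟨hlift Q₁ hj₁, hQZ Q₁ rfl⟩
  have hQ₂ : Q₂ ∈ C \ (Subtype.val ⁻¹' Z : Set X) := ⟨hlift Q₂ hj₂, hQZ Q₂ rfl⟩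
  have hpath := ((hCo.sdiff hZcl).isConnected_iff_isPathConnected.1 ⟨⟨Q₁, hQ₁⟩, hpre⟩).joinedIn
    Q₁ hQ₁ Q₂ hQ₂
  have hpath' : JoinedIn (ES A (matrixBall (combo A p.1) ε' ∩ core A)) (σ β, μ₁) (σ β, μ₂) := by
    refine (hpath.map continuous_subtype_val).mono ?_
    rintro - ⟨q, ⟨hqC, hqZ⟩, rfl⟩
    have hqW : q ∈ W := pathComponentIn_subset hqC
    exact ⟨q.2.2.1, ⟨hqW.2.2.1.1, hcore q hqZ⟩, q.2.2.2.2⟩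
  exact (joinedIn_fibre h₁ hσβ hσβ').trans (hpath'.trans (joinedIn_fibre h₂ hσβ hσβ').symm)

open scoped Manifold in
/-- If a neighbourhood of `p` in the eigen-surface is a topological manifold, possibly with
boundary, then the matrix is locally non-transitive about `p`. -/
theorem locallyNonTransitive_of_isTopologicalManifold {A : Fin k → Matrix (Fin n) (Fin n) ℂ}
    (hreg : IsRegular A) (hcodim : CodimAtLeastTwo A) {p : (Fin k → ℝ) × ℂ}
    (hp : p ∈ ES A (Co A)) {ε : ℝ} (hε : 0 < ε)
    (h : IsTopologicalManifold ↥(pointBall p ε ∩ ES A (Co A))) : LocallyNonTransitive A p := by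
  obtain ⟨-, -, m, ⟨⟨hc⟩⟩ | ⟨⟨hc⟩⟩⟩ := h
  · exact locallyNonTransitive_of_chartedSpace hreg hcodim hp hε (𝓡 m)
  · exact locallyNonTransitive_of_chartedSpace hreg hcodim hp hε (𝓡∂ (m + 1))

end Localization

end EigenSurface

theorem mainTheorem5 {n k : ℕ} (A : Fin k → Matrix (Fin n) (Fin n) ℂ)
    (hreg : EigenSurface.IsRegular A)
    (hcodim : EigenSurface.CodimAtLeastTwo A)
    (p : (Fin k → ℝ) × ℂ)
    (hp : p ∈ EigenSurface.ES A (EigenSurface.Co A))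
    (hU : EigenSurface.combo A p.1 ∈ EigenSurface.nonCore A)
    (hmult : 1 < (EigenSurface.combo A p.1).charpoly.rootMultiplicity p.2)
    (hnot : ¬ EigenSurface.LocallyNonTransitive A p) :
    ¬ ∃ ε > 0, EigenSurface.IsTopologicalManifold
      ↥(EigenSurface.pointBall p ε ∩ EigenSurface.ES A (EigenSurface.Co A)) := by
  rintro ⟨ε, hε, h⟩
  exact hnot (EigenSurface.locallyNonTransitive_of_isTopologicalManifold hreg hcodim hp hε h)
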